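/- Let $d\ge 1$ and let $\mu$ be a Borel probability measure on $\mathbb{R}^d$ that is absolutely continuous with respect to Lebesgue measure and whose support $\mathcal{S}$ (the smallest closed set of $\mu$-measure one) is convex. A finitely discrete probability measure is a measure $\nu=\sum_{i=1}^n\lambda_i\delta_{x_i}$ with distinct atoms $x_1,\dots,x_n\in\mathbb{R}^d$ and weights $\lambda_i>0$, $\sum_i\lambda_i=1$; it is called empirical if $\lambda_1=\dots=\lambda_n=1/n$. For such $\nu$, let $Q_\nu$ be the ($\mu$-a.e. unique) gradient of a convex function $\psi:\mathbb{R}^d\to\mathbb{R}\cup\{\infty\}$ that pushes $\mu$ forward to $\nu$ (the optimal transport map). For $u\in\mathcal{S}$, the breakdown point of $Q_\nu(u)$ is $$\mathrm{BDP}(Q_\nu(u))=\min\Big\{\sum_{i\in I}\lambda_i:\ I\subset\{1,\dots,n\},\ \ \sup_{\tilde\nu}\int_{\mathcal{B}_\delta(u)}\|Q_\nu(x)-Q_{\tilde\nu}(x)\|\,d\mu(x)=\infty\ \text{ for all }\delta>0\Big\},$$ where $\mathcal{B}_\delta(u)$ is the open ball with center $u$ and radius $\delta$, and where the supremum is over all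 finitely discrete probability measures $\tilde\nu$ on $\mathbb{R}^d$ (with any number of atoms, and any other atoms and weights) such that $\tilde\nu(\{x_i\})=\lambda_i$ for every $i\notin I$. The halfspace depth of $u\in\mathbb{R}^d$ is $HD(u,\mu)=\inf\{\mu(H): H\text{ a closed halfspace containing }u\}$, and a Tukey median of $\mu$ is a maximizer of $HD(\cdot,\mu)$ over $\mathcal{S}$. Then the minimum defining $\mathrm{BDP}(Q_\nu(u))$ exists for every such $\nu$ and every $u\in\mathcal{S}$, a Tukey median of $\mu$ exists, and the following holds. (i) For every Tukey median $u_*$ of $\mu$ and every finitely discrete probability measure $\nu$ as above, $$\max_{u\in\mathcal{S}}\mathrm{BDP}(Q_\nu(u))=\mathrm{BDP}(Q_\nu(u_*))\ \ge\ \min\Big\{\sum_{i\in I}\lambda_i:\ I\subset\{1,\dots,n\},\ \sum_{i\in I}\lambda_i\ge\frac1{d+1}\Big\}.$$ (ii) If $\mu$ is angularly symmetric about $\theta\in\mathbb{R}^d$, that is, $\mu(\theta-B)=\mu(\theta+B)$ for every Borel set $B\subset\mathbb{R}^d$ such that $rB=B$ for all $r>0$, then $u_*=\theta$ is the unique Tukey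 median of $\mu$, and for every $\nu$ as above $$\mathrm{BDP}(Q_\nu(u_*))=\min\Big\{\sum_{i\in I}\lambda_i:\ I\subset\{1,\dots,n\},\ \sum_{i\in I}\lambda_i\ge\frac12\Big\}.$$ In particular, for empirical target measures $\nu_n$ with $n\ge1$ atoms, $\mathrm{BDP}(Q_{\nu_n}(u_*))=\lceil n/2\rceil/n$, so that $\mathrm{BDP}(Q_{\nu_n}(u_*))\to 1/2$ as $n\to\infty$. -/

import Mathlib

open MeasureTheory Filter Topology
open scoped ENNReal

noncomputable section

namespace SemiDiscreteOT

variable {d n : ℕ}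

/-- The discrete measure `∑ i, lam i • δ_{x i}`. -/
def discreteMeasure (x : Fin n → EuclideanSpace ℝ (Fin d)) (lam : Fin n → ℝ) :
    Measure (EuclideanSpace ℝ (Fin d)) :=
  ∑ i, ENNReal.ofReal (lam i) • Measure.dirac (x i)

/-- `x` lists the (distinct) atoms and `lam` the (positive) weights of a finitely discrete
probability measure. -/
structure IsAtomsWeights (x : Fin n → EuclideanSpace ℝ (Fin d)) (lam : Fin n → ℝ) : Prop where
  atoms_injective : Function.Injective x
  weight_pos : ∀ i, 0 < lam i
  weight_sum : ∑ i, lam i = 1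

/-- `Q` is the gradient of a convex function `ψ : ℝ^d → ℝ ∪ {∞}` and pushes `μ` forward to `ν`.
The convex function is given by its effective domain `D` (where it is finite) and its values on
`D`; `μ`-almost every point is an interior point of `D` at which `ψ` is differentiable with
gradient `Q`. -/
def IsBrenierMap (μ ν : Measure (EuclideanSpace ℝ (Fin d)))
    (Q : EuclideanSpace ℝ (Fin d) → EuclideanSpace ℝ (Fin d)) : Prop :=
  (∃ (D : Set (EuclideanSpace ℝ (Fin d))) (ψ : EuclideanSpace ℝ (Fin d) → ℝ),
    ConvexOn ℝ D ψ ∧ ∀ᵐ z ∂μ, z ∈ interior D ∧ HasGradientAt ψ (Q z) z) ∧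
  Measurable Q ∧ μ.map Q = ν

open Classical in
/-- The optimal transport map `Q_ν` from `μ` to `ν`: the gradient of a convex function that
pushes `μ` forward to `ν`. For absolutely continuous `μ` it exists and is unique up to
`μ`-null sets, so that integrals against `μ` do not depend on the version chosen here. -/
def otMap (μ ν : Measure (EuclideanSpace ℝ (Fin d))) :
    EuclideanSpace ℝ (Fin d) → EuclideanSpace ℝ (Fin d) :=
  if h : ∃ Q, IsBrenierMap μ ν Q then h.choose else 0

/-- The contaminated target measures: the finitely discrete probability measures that give mass
`lam i` to `{x i}` for each uncontaminated index `i ∉ I` (in particular each such `x i` is one of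
their atoms). Number, positions and weights of the other atoms are free. -/
def contaminations (x : Fin n → EuclideanSpace ℝ (Fin d)) (lam : Fin n → ℝ)
    (I : Finset (Fin n)) : Set (Measure (EuclideanSpace ℝ (Fin d))) :=
  {ν' | (∃ (m : ℕ) (y : Fin m → EuclideanSpace ℝ (Fin d)) (w : Fin m → ℝ),
      IsAtomsWeights y w ∧ ν' = discreteMeasure y w) ∧
    ∀ i, i ∉ I → ν' {x i} = ENNReal.ofReal (lam i)}

/-- Contamination of the atoms with index in `I` breaks `Q_ν(u)` down: for every `δ > 0` the
supremum over contaminated targets `ν'` of `∫_{B_δ(u)} ‖Q_ν - Q_{ν'}‖ dμ` is infinite. -/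
def BreaksDown (μ : Measure (EuclideanSpace ℝ (Fin d)))
    (x : Fin n → EuclideanSpace ℝ (Fin d)) (lam : Fin n → ℝ)
    (u : EuclideanSpace ℝ (Fin d)) (I : Finset (Fin n)) : Prop :=
  ∀ δ : ℝ, 0 < δ →
    (⨆ ν' ∈ contaminations x lam I,
      ∫⁻ z in Metric.ball u δ, ‖otMap μ (discreteMeasure x lam) z - otMap μ ν' z‖ₑ ∂μ) = ∞

/-- The total contamination masses that break `Q_ν(u)` down. -/
def breakdownMasses (μ : Measure (EuclideanSpace ℝ (Fin d)))
    (x : Fin n → EuclideanSpace ℝ (Fin d)) (lam : Fin n → ℝ)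
    (u : EuclideanSpace ℝ (Fin d)) : Set ℝ :=
  {s | ∃ I : Finset (Fin n), BreaksDown μ x lam u I ∧ s = ∑ i ∈ I, lam i}

/-- The breakdown point of `Q_ν(u)`, where `ν = ∑ i, lam i • δ_{x i}`: the minimum of the
(finite) set of contamination masses that break `Q_ν(u)` down. -/
def breakdownPoint (μ : Measure (EuclideanSpace ℝ (Fin d)))
    (x : Fin n → EuclideanSpace ℝ (Fin d)) (lam : Fin n → ℝ)
    (u : EuclideanSpace ℝ (Fin d)) : ℝ :=
  sInf (breakdownMasses μ x lam u)

/-- The sums `∑ i ∈ I, lam i`, `I ⊆ {1, …, n}`, that are at least `t`. -/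
def weightSumsGE (lam : Fin n → ℝ) (t : ℝ) : Set ℝ :=
  {s | ∃ I : Finset (Fin n), s = ∑ i ∈ I, lam i ∧ t ≤ s}

/-- Closed halfspaces of `ℝ^d`. -/
def IsClosedHalfspace (H : Set (EuclideanSpace ℝ (Fin d))) : Prop :=
  ∃ (v : EuclideanSpace ℝ (Fin d)) (c : ℝ), v ≠ 0 ∧ H = {z | c ≤ inner ℝ v z}

/-- The Tukey halfspace depth of `u` with respect to `μ`: the infimum of the `μ`-measures of the
closed halfspaces that contain `u`. -/
def halfspaceDepth (μ : Measure (EuclideanSpace ℝ (Fin d))) (u : EuclideanSpace ℝ (Fin d)) :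
    ℝ≥0∞ :=
  ⨅ (H : Set (EuclideanSpace ℝ (Fin d))) (_ : IsClosedHalfspace H ∧ u ∈ H), μ H

/-- `u` is a Tukey median of `μ`: it maximizes halfspace depth over the support of `μ`. -/
def IsTukeyMedian (μ : Measure (EuclideanSpace ℝ (Fin d))) (u : EuclideanSpace ℝ (Fin d)) :
    Prop :=
  u ∈ μ.support ∧ ∀ z ∈ μ.support, halfspaceDepth μ z ≤ halfspaceDepth μ u

/-- `μ` is angularly symmetric about `θ`: `μ (θ - B) = μ (θ + B)` for each Borel cone `B`. -/
def AngularlySymmetric (μ : Measure (EuclideanSpace ℝ (Fin d)))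
    (θ : EuclideanSpace ℝ (Fin d)) : Prop :=
  ∀ B : Set (EuclideanSpace ℝ (Fin d)), MeasurableSet B →
    (∀ r : ℝ, 0 < r → (fun z => r • z) '' B = B) →
    μ ((fun z => θ - z) '' B) = μ ((fun z => θ + z) '' B)

end SemiDiscreteOT

end

open SemiDiscreteOT

/-! The breakdown point is governed by one equivalence: for nonempty `I` and `u` in the support,
contaminating `I` breaks `Q_ν(u)` down exactly when the weight of `I` is at least the halfspace
depth of `u`. Both directions rest on the monotonicity of Brenier maps
(`IsBrenierMap.exists_monotone`) and on hyperplanes being null.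

If the weight is below the depth, every cone slightly narrower than a halfspace, with vertex near
`u`, carries more mass than the contamination. A very long value of the map at the vertex would, by
monotonicity, forbid the uncontaminated atoms as values on the cone opening in its direction,
leaving too much mass for the contaminated part. Hence the maps are uniformly bounded near `u`
(`exists_ae_norm_otMap_le`).

If the weight is at least the depth, choose a halfspace at `u` of least mass, with inner normal `v`,
and send the atoms in `I` to infinity along `v`. Monotonicity makes them attract the mass lying
highest in direction `v`, including some near `u` (`breaksDown_of_halfspaceDepth_le`). The maps to
these targets exist by a Laguerre cell construction.

At positive depth the breakdown point is thus the least subset weight not below the depth, so deeper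
points are at least as robust. Helly's theorem gives a Tukey median depth at least `1 / (d + 1)`;
angular symmetry gives `θ` depth `1 / 2`, and convexity of the support makes every other point of
the support strictly shallower. -/

namespace SemiDiscreteOT

/-! ### Continuity of the masses of halfspaces and cones -/

section Generic

variable {E : Type*} [NormedAddCommGroup E] [InnerProductSpace ℝ E] [MeasurableSpace E]
  [BorelSpace E] {μ : Measure E} [IsFiniteMeasure μ]

theorem tendsto_measure_of_ae_eventually_mem_iff {α ι : Type*} [MeasurableSpace α]
    {μ : Measure α} [IsFiniteMeasure μ] {l : Filter ι} [l.IsCountablyGenerated]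
    {s : ι → Set α} {A : Set α} (hs : ∀ i, MeasurableSet (s i)) (hA : MeasurableSet A)
    (h : ∀ᵐ x ∂μ, ∀ᶠ i in l, (x ∈ s i ↔ x ∈ A)) :
    Tendsto (fun i => μ (s i)) l (𝓝 (μ A)) :=
  tendsto_measure_of_ae_tendsto_indicator_of_isFiniteMeasure l hA hs
    (h.mono fun _ hx => hx)

theorem tendsto_measure_setOf_le_atTop {α : Type*} [MeasurableSpace α] (μ : Measure α)
    [IsFiniteMeasure μ] {f : α → ℝ} (hf : Measurable f) :
    Tendsto (fun t : ℝ => μ {x | t ≤ f x}) atTop (𝓝 0) := by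
  have := tendsto_measure_of_ae_eventually_mem_iff (μ := μ) (l := atTop)
    (s := fun t : ℝ => {x | t ≤ f x}) (A := ∅) (fun t => measurableSet_le measurable_const hf)
    MeasurableSet.empty (Eventually.of_forall fun x => by
      filter_upwards [eventually_gt_atTop (f x)] with t ht
      simpa using ht)
  simpa using this

/-- Continuity of the mass of the cones `{η ‖x - u‖ ≤ ⟪v, x - u⟫}` at `η = 0`. -/
theorem tendsto_measure_cone (hμ : ∀ v : E, v ≠ 0 → ∀ c : ℝ, μ {z | inner ℝ v z = c} = 0)
    {v : E} (hv : v ≠ 0) (u : E) [SecondCountableTopology E] :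
    Tendsto (fun p : E × E × ℝ => μ {x | p.2.2 * ‖x - p.2.1‖ ≤ inner ℝ p.1 (x - p.2.1)})
      (𝓝 (v, u, 0)) (𝓝 (μ {x | 0 ≤ inner ℝ v (x - u)})) := by
  apply tendsto_measure_of_ae_eventually_mem_iff
  · intro p
    exact (isClosed_le (by fun_prop) (by fun_prop)).measurableSet
  · exact (isClosed_le (by fun_prop) (by fun_prop)).measurableSet
  -- Off the null boundary hyperplane the limiting inequality is strict, so membership is stable
  -- under small changes of direction, vertex and aperture.
  · have h0 : ∀ᵐ x ∂μ, inner ℝ v x ≠ inner ℝ v u := by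
      rw [ae_iff]; simpa using hμ v hv _
    filter_upwards [h0] with x hx
    have hx' : inner ℝ v (x - u) ≠ 0 := by rw [inner_sub_right]; exact sub_ne_zero.2 hx
    have hc : Continuous fun p : E × E × ℝ =>
      inner ℝ p.1 (x - p.2.1) - p.2.2 * ‖x - p.2.1‖ := by fun_prop
    have ht := hc.tendsto (v, u, 0)
    simp only [zero_mul, sub_zero] at ht
    rcases lt_or_gt_of_ne hx' with h | h
    · filter_upwards [ht.eventually_lt_const h] with p hp
      simp only [not_le.2 h, iff_false, not_le]
      linarith
    · filter_upwards [ht.eventually_const_lt h] with p hp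
      simp only [h.le, iff_true]
      linarith

theorem tendsto_measure_halfspace (hμ : ∀ v : E, v ≠ 0 → ∀ c : ℝ, μ {z | inner ℝ v z = c} = 0)
    {v : E} (hv : v ≠ 0) (c : ℝ) :
    Tendsto (fun t : ℝ => μ {x | t ≤ inner ℝ v x}) (𝓝 c) (𝓝 (μ {x | c ≤ inner ℝ v x})) := by
  apply tendsto_measure_of_ae_eventually_mem_iff
  · exact fun p => (isClosed_le (by fun_prop) (by fun_prop)).measurableSet
  · exact (isClosed_le (by fun_prop) (by fun_prop)).measurableSet
  · have h0 : ∀ᵐ x ∂μ, inner ℝ v x ≠ c := by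
      rw [ae_iff]; simpa using hμ v hv c
    filter_upwards [h0] with x hx
    rcases lt_or_gt_of_ne hx with h | h
    · filter_upwards [lt_mem_nhds h] with p hp
      simp [not_le.2 h, hp]
    · filter_upwards [gt_mem_nhds h] with p hp
      simp [h.le, (show p < _ from hp).le]

end Generic

theorem measure_halfspace_sub {E : Type*} [NormedAddCommGroup E] [InnerProductSpace ℝ E]
    [MeasurableSpace E] (μ : Measure E) (v u : E) (t : ℝ) :
    μ {x | t ≤ inner ℝ v (x - u)} = μ {x | t + inner ℝ v u ≤ inner ℝ v x} := by
  congr 1; ext x; simp only [inner_sub_right, Set.mem_ofPred_eq]; constructor <;> intro h <;> linarith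

theorem measure_hyperplane_eq_zero {d : ℕ} {μ : Measure (EuclideanSpace ℝ (Fin d))}
    (hac : μ ≪ volume) (v : EuclideanSpace ℝ (Fin d)) (hv : v ≠ 0) (c : ℝ) :
    μ {z | inner ℝ v z = c} = 0 := by
  apply hac
  let L := innerSL ℝ v
  let A : AffineSubspace ℝ (EuclideanSpace ℝ (Fin d)) :=
    (AffineSubspace.mk' c (⊥ : Submodule ℝ ℝ)).comap L.toLinearMap.toAffineMap
  have hA : {z | inner ℝ v z = c} = (A : Set (EuclideanSpace ℝ (Fin d))) := by
    ext z
    simp [A, L, AffineSubspace.mem_mk', sub_eq_zero]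
  rw [hA]
  apply Measure.addHaar_affineSubspace
  intro h
  have h1 : ∀ z, inner ℝ v z = c := fun z => by
    have : z ∈ (A : Set (EuclideanSpace ℝ (Fin d))) := by rw [h]; trivial
    rwa [← hA] at this
  have h2 := h1 0
  have h3 := h1 v
  rw [inner_zero_right] at h2
  rw [← h2, inner_self_eq_zero] at h3
  exact hv h3

/-- A Brenier map is monotone on a set of full measure. -/
theorem IsBrenierMap.exists_monotone {d : ℕ} {μ ν : Measure (EuclideanSpace ℝ (Fin d))}
    {Q : EuclideanSpace ℝ (Fin d) → EuclideanSpace ℝ (Fin d)} (h : IsBrenierMap μ ν Q) :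
    ∃ G : Set (EuclideanSpace ℝ (Fin d)), (∀ᵐ z ∂μ, z ∈ G) ∧
      ∀ a ∈ G, ∀ b ∈ G, 0 ≤ inner ℝ (Q a - Q b) (a - b) := by
  obtain ⟨⟨D, ψ, hψ, hae⟩, -, -⟩ := h
  refine ⟨{z | z ∈ interior D ∧ HasGradientAt ψ (Q z) z}, hae, ?_⟩
  -- Subgradient inequality, from convexity on the segment from `a` to `b`; adding it to its mirror
  -- image gives monotonicity.
  have key : ∀ a b, a ∈ interior D → HasGradientAt ψ (Q a) a → b ∈ D →
      inner ℝ (Q a) (b - a) ≤ ψ b - ψ a := by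
    intro a b ha hga hb
    have hc : ConvexOn ℝ (AffineMap.lineMap a b ⁻¹' D) (ψ ∘ (AffineMap.lineMap a b : ℝ →ᵃ[ℝ] _)) :=
      hψ.comp_affineMap _
    have hd : HasDerivAt (ψ ∘ (AffineMap.lineMap a b : ℝ →ᵃ[ℝ] _)) (inner ℝ (Q a) (b - a)) 0 := by
      have h1 : HasFDerivAt ψ (InnerProductSpace.toDual ℝ _ (Q a)) (AffineMap.lineMap a b (0 : ℝ)) := by
        simpa using hga.hasFDerivAt
      have h2 := h1.comp_hasDerivAt (0 : ℝ) (AffineMap.hasDerivAt_lineMap (a := a) (b := b))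
      simpa using h2
    have := hc.le_slope_of_hasDerivAt (x := 0) (y := 1) (by simpa using interior_subset ha)
      (by simpa using hb) one_pos hd
    simpa [slope_def_field] using this
  rintro a ⟨ha, hga⟩ b ⟨hb, hgb⟩
  have h1 := key a b ha hga (interior_subset hb)
  have h2 := key b a hb hgb (interior_subset ha)
  rw [← neg_sub a b, inner_neg_right] at h1
  rw [inner_sub_left]
  linarith

end SemiDiscreteOT

/-! ### Semidiscrete transport by Laguerre cells -/

noncomputable section

namespace SemiDiscreteOT

section Laguerre

variable {E : Type*} [NormedAddCommGroup E] [InnerProductSpace ℝ E] {n : ℕ}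

/-- The Laguerre cell of the atom `x i` for the weights `w`. -/
def laguerreCell (x : Fin n → E) (w : Fin n → ℝ) (i : Fin n) : Set E :=
  {z | ∀ j, inner ℝ (x j) z - w j ≤ inner ℝ (x i) z - w i}

/-- The points at which `x i` is the only maximizer of `⟪x j, z⟫ - w j`. -/
def strictLaguerreCell (x : Fin n → E) (w : Fin n → ℝ) (i : Fin n) : Set E :=
  {z | ∀ j, j ≠ i → inner ℝ (x j) z - w j < inner ℝ (x i) z - w i}

theorem isClosed_laguerreCell (x : Fin n → E) (w : Fin n → ℝ) (i : Fin n) :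
    IsClosed (laguerreCell x w i) := by
  have : laguerreCell x w i = ⋂ j, {z | inner ℝ (x j) z - w j ≤ inner ℝ (x i) z - w i} := by
    ext z; simp [laguerreCell]
  rw [this]
  exact isClosed_iInter fun j => isClosed_le (by fun_prop) (by fun_prop)

theorem isOpen_strictLaguerreCell (x : Fin n → E) (w : Fin n → ℝ) (i : Fin n) :
    IsOpen (strictLaguerreCell x w i) := by
  have : strictLaguerreCell x w i =
      ⋂ j, {z | j ≠ i → inner ℝ (x j) z - w j < inner ℝ (x i) z - w i} := by
    ext z; simp [strictLaguerreCell]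
  rw [this]
  refine isOpen_iInter_of_finite fun j => ?_
  by_cases h : j = i
  · simp [h]
  · simpa [h] using isOpen_lt (by fun_prop) (by fun_prop)

theorem disjoint_strictLaguerreCell (x : Fin n → E) (w : Fin n → ℝ) {i j : Fin n} (h : i ≠ j) :
    Disjoint (strictLaguerreCell x w i) (strictLaguerreCell x w j) := by
  rw [Set.disjoint_left]
  intro z hi hj
  exact lt_asymm (hi j h.symm) (hj i h)

theorem strictLaguerreCell_subset (x : Fin n → E) (w : Fin n → ℝ) (i : Fin n) :
    strictLaguerreCell x w i ⊆ laguerreCell x w i := by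
  intro z hz j
  by_cases h : j = i
  · rw [h]
  · exact (hz j h).le

theorem ae_ne_of_hyperplane [MeasurableSpace E] {μ : Measure E}
    (hμ : ∀ v : E, v ≠ 0 → ∀ c : ℝ, μ {z | inner ℝ v z = c} = 0)
    {x : Fin n → E} (hx : Function.Injective x) (w : Fin n → ℝ) :
    ∀ᵐ z ∂μ, ∀ i j, i ≠ j → inner ℝ (x j) z - w j ≠ inner ℝ (x i) z - w i := by
  simp only [ae_all_iff]
  intro i j hij
  rw [ae_iff]
  refine measure_mono_null ?_ (hμ (x j - x i) (sub_ne_zero.2 fun h => hij (hx h.symm)) (w j - w i))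
  intro z hz
  simp only [ne_eq, not_not, Set.mem_ofPred_eq, inner_sub_left] at hz ⊢
  linarith

theorem ae_mem_laguerreCell_iff [MeasurableSpace E] {μ : Measure E}
    (hμ : ∀ v : E, v ≠ 0 → ∀ c : ℝ, μ {z | inner ℝ v z = c} = 0)
    {x : Fin n → E} (hx : Function.Injective x) (w : Fin n → ℝ) :
    ∀ᵐ z ∂μ, ∀ i, z ∈ laguerreCell x w i ↔ z ∈ strictLaguerreCell x w i := by
  filter_upwards [ae_ne_of_hyperplane hμ hx w] with z hz i
  exact ⟨fun h j hj => lt_of_le_of_ne (h j) (hz i j hj.symm),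
    fun h => strictLaguerreCell_subset x w i h⟩

theorem ae_exists_mem_strictLaguerreCell [NeZero n] [MeasurableSpace E] {μ : Measure E}
    (hμ : ∀ v : E, v ≠ 0 → ∀ c : ℝ, μ {z | inner ℝ v z = c} = 0)
    {x : Fin n → E} (hx : Function.Injective x) (w : Fin n → ℝ) :
    ∀ᵐ z ∂μ, ∃ i, z ∈ strictLaguerreCell x w i := by
  filter_upwards [ae_mem_laguerreCell_iff hμ hx w] with z hz
  obtain ⟨i, hi⟩ := Finite.exists_max fun i => inner ℝ (x i) z - w i
  exact ⟨i, (hz i).1 hi⟩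

theorem measure_laguerreCell_eq [MeasurableSpace E] {μ : Measure E}
    (hμ : ∀ v : E, v ≠ 0 → ∀ c : ℝ, μ {z | inner ℝ v z = c} = 0)
    {x : Fin n → E} (hx : Function.Injective x) (w : Fin n → ℝ) (i : Fin n) :
    μ (strictLaguerreCell x w i) = μ (laguerreCell x w i) := by
  apply measure_congr
  filter_upwards [ae_mem_laguerreCell_iff hμ hx w] with z hz
  exact propext (hz i).symm

variable [MeasurableSpace E] [BorelSpace E] {μ : Measure E} [IsProbabilityMeasure μ]

/-- Off the null set of ties, membership in a cell is locally constant in the weights, so dominated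
convergence applies. -/
theorem continuous_measure_laguerreCell
    (hμ : ∀ v : E, v ≠ 0 → ∀ c : ℝ, μ {z | inner ℝ v z = c} = 0)
    {x : Fin n → E} (hx : Function.Injective x) (i : Fin n) :
    Continuous fun w : Fin n → ℝ => μ.real (laguerreCell x w i) := by
  rw [continuous_iff_continuousAt]
  intro w
  refine (ENNReal.tendsto_toReal (measure_ne_top μ _)).comp
    (tendsto_measure_of_ae_eventually_mem_iff
      (fun w => (isClosed_laguerreCell x w i).measurableSet)
      (isClosed_laguerreCell x w i).measurableSet ?_)
  filter_upwards [ae_mem_laguerreCell_iff hμ hx w] with z hz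
  have hc : ∀ j, Continuous fun w : Fin n → ℝ => inner ℝ (x j) z - w j := fun j => by fun_prop
  by_cases h : z ∈ laguerreCell x w i
  · have h' := (hz i).1 h
    have : ∀ᶠ w' in 𝓝 w, ∀ j, j ≠ i → inner ℝ (x j) z - w' j < inner ℝ (x i) z - w' i := by
      simp only [eventually_all]
      exact fun j hj => (hc j).continuousAt.eventually_lt (hc i).continuousAt (h' j hj)
    filter_upwards [this] with w' hw'
    exact iff_of_true (strictLaguerreCell_subset x w' i hw') h
  · obtain ⟨j, hj⟩ : ∃ j, inner ℝ (x i) z - w i < inner ℝ (x j) z - w j := by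
      by_contra! h'
      exact h h'
    filter_upwards [(hc i).continuousAt.eventually_lt (hc j).continuousAt hj] with w' hw'
    exact iff_of_false (fun h'' => not_le.2 hw' (h'' j)) h

theorem sum_measure_laguerreCell [NeZero n]
    (hμ : ∀ v : E, v ≠ 0 → ∀ c : ℝ, μ {z | inner ℝ v z = c} = 0)
    {x : Fin n → E} (hx : Function.Injective x) (w : Fin n → ℝ) :
    ∑ i, μ.real (laguerreCell x w i) = 1 := by
  have h1 : μ (⋃ i ∈ Finset.univ, strictLaguerreCell x w i) =
      ∑ i, μ (strictLaguerreCell x w i) :=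
    measure_biUnion_finset (fun i _ j _ h => disjoint_strictLaguerreCell x w h)
      fun i _ => (isOpen_strictLaguerreCell x w i).measurableSet
  have h2 : μ (⋃ i ∈ Finset.univ, strictLaguerreCell x w i) = 1 := by
    rw [← prob_compl_eq_zero_iff₀, ← mem_ae_iff]
    · filter_upwards [ae_exists_mem_strictLaguerreCell hμ hx w] with z hz
      simpa using hz
    · exact (isOpen_biUnion fun i _ => isOpen_strictLaguerreCell x w i).nullMeasurableSet
  rw [h2] at h1
  simp only [measureReal_def, ← measure_laguerreCell_eq hμ hx]
  rw [← ENNReal.toReal_sum fun i _ => measure_ne_top μ _, ← h1, ENNReal.toReal_one]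

/-- Normalize `w i₀ = 0` and minimize `∑ i, w i` among weights for which no other cell exceeds its
prescribed mass. A deficient cell could still be enlarged by lowering its weight, so at a minimum
there is none. -/
theorem exists_measure_laguerreCell_eq [NeZero n]
    (hμ : ∀ v : E, v ≠ 0 → ∀ c : ℝ, μ {z | inner ℝ v z = c} = 0)
    {x : Fin n → E} (hx : Function.Injective x) {lam : Fin n → ℝ} (hpos : ∀ i, 0 < lam i)
    (hsum : ∑ i, lam i = 1) :
    ∃ w : Fin n → ℝ, ∀ i, μ.real (laguerreCell x w i) = lam i := by
  let i₀ : Fin n := 0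
  have htail : ∀ i j, ∀ ε > 0, ∀ᶠ t : ℝ in atTop, μ.real {z | t ≤ inner ℝ (x i - x j) z} < ε := by
    intro i j ε hε
    have h := (ENNReal.tendsto_toReal ENNReal.zero_ne_top).comp
      (tendsto_measure_setOf_le_atTop μ (f := fun z => inner ℝ (x i - x j) z)
        (by fun_prop : Continuous _).measurable)
    exact h.eventually_lt_const (by simpa using hε)
  -- Weight `t` away from `i₀` makes every other cell small, which provides the feasible point `w₀`.
  obtain ⟨t, ht⟩ : ∃ t : ℝ, ∀ i, μ.real {z | t ≤ inner ℝ (x i - x i₀) z} < lam i :=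
    (eventually_all.2 fun i => htail i i₀ (lam i) (hpos i)).exists
  obtain ⟨B, hBt, hB⟩ : ∃ B : ℝ, -t ≤ B ∧ 0 ≤ B ∧
      ∀ j, μ.real {z | B ≤ inner ℝ (x i₀ - x j) z} < lam i₀ :=
    ((eventually_ge_atTop _).and ((eventually_ge_atTop _).and
      (eventually_all.2 fun j => htail i₀ j (lam i₀) (hpos i₀)))).exists
  obtain ⟨hB0, hB⟩ := hB
  let w₀ : Fin n → ℝ := fun i => if i = i₀ then 0 else t
  let W : Set (Fin n → ℝ) := {w | w i₀ = 0 ∧ ∀ i, i ≠ i₀ → μ.real (laguerreCell x w i) ≤ lam i}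
  have hgc := continuous_measure_laguerreCell hμ hx
  have hWc : IsClosed W := by
    have : W = {w | w i₀ = 0} ∩ ⋂ i, {w | i ≠ i₀ → μ.real (laguerreCell x w i) ≤ lam i} := by
      ext w; simp [W]
    rw [this]
    refine (isClosed_eq (by fun_prop) (by fun_prop)).inter (isClosed_iInter fun i => ?_)
    by_cases h : i = i₀
    · simp [h]
    · simpa [h] using isClosed_le (hgc i) continuous_const
  -- Feasibility forces cell `i₀` to have mass at least `lam i₀`; a weight below `-B` would confine
  -- that cell to a halfspace of smaller mass.
  have hWB : ∀ w ∈ W, ∀ j, -B ≤ w j := by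
    intro w hw j
    by_contra! hlt
    have h1 : lam i₀ ≤ μ.real (laguerreCell x w i₀) := by
      have h2 := sum_measure_laguerreCell hμ hx w
      rw [← hsum, ← Finset.add_sum_erase _ _ (Finset.mem_univ i₀),
        ← Finset.add_sum_erase _ _ (Finset.mem_univ i₀)] at h2
      have h3 := Finset.sum_le_sum fun i (hi : i ∈ Finset.univ.erase i₀) =>
        hw.2 i (Finset.ne_of_mem_erase hi)
      linarith
    have h2 : μ.real (laguerreCell x w i₀) ≤ μ.real {z | B ≤ inner ℝ (x i₀ - x j) z} := by
      refine measureReal_mono fun z hz => ?_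
      have := hz j
      rw [hw.1] at this
      simp only [Set.mem_ofPred_eq, inner_sub_left]
      linarith
    linarith [hB j]
  have hw₀ : w₀ ∈ W := by
    refine ⟨by simp [w₀], fun i hi => le_trans (measureReal_mono fun z hz => ?_) (ht i).le⟩
    have := hz i₀
    simp only [w₀, hi, if_true, if_false, Set.mem_ofPred_eq, inner_sub_left] at this ⊢
    linarith
  have hcpt : IsCompact (W ∩ Set.Icc (fun _ => -B) w₀) := isCompact_Icc.inter_left hWc
  obtain ⟨w, hw, hmin⟩ := hcpt.exists_isMinOn ⟨w₀, hw₀, fun j => hWB w₀ hw₀ j, le_rfl⟩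
    (f := fun w => ∑ i, w i) (by fun_prop)
  have heq : ∀ i, i ≠ i₀ → μ.real (laguerreCell x w i) = lam i := by
    intro i hi
    refine le_antisymm (hw.1.2 i hi) (not_lt.1 fun hlt => ?_)
    have hcont : Continuous fun ε : ℝ => μ.real (laguerreCell x (w - ε • Pi.single i (1 : ℝ)) i) :=
      (hgc i).comp (by fun_prop)
    have h0 := hcont.tendsto 0
    simp only [zero_smul, sub_zero] at h0
    obtain ⟨ε, hε, hε0⟩ := ((h0.eventually_lt_const hlt).filter_mono nhdsWithin_le_nhds).and
      (self_mem_nhdsWithin (s := Set.Ioi (0 : ℝ))) |>.exists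
    have hε0 : 0 < ε := hε0
    set w' := w - ε • Pi.single i (1 : ℝ) with hw'
    have hw'i : w' i = w i - ε := by simp [hw']
    have hw'j : ∀ j, j ≠ i → w' j = w j := fun j hj => by simp [hw', hj]
    have hle : w' ≤ w := by
      intro j
      by_cases hj : j = i
      · rw [hj, hw'i]; linarith
      · rw [hw'j j hj]
    have hmem : w' ∈ W := by
      refine ⟨by rw [hw'j _ hi.symm, hw.1.1], fun j hj => ?_⟩
      by_cases hji : j = i
      · rw [hji]; exact hε.le
      -- Lowering only the weight of `i` makes the competitor `i` stronger, so every other cell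
      -- shrinks.
      · refine le_trans (measureReal_mono ?_) (hw.1.2 j hj)
        intro z hz k
        have h1 := hz k
        have h2 := hle k
        rw [hw'j j hji] at h1
        linarith
    have h1 : ∑ i, w i ≤ ∑ i, w' i :=
      hmin ⟨hmem, fun j => hWB w' hmem j, hle.trans hw.2.2⟩
    have h2 : ∑ i, w' i < ∑ i, w i :=
      Finset.sum_lt_sum (fun j _ => hle j) ⟨i, Finset.mem_univ i, by rw [hw'i]; linarith⟩
    linarith
  refine ⟨w, fun i => ?_⟩
  by_cases hi : i = i₀
  · have h2 := sum_measure_laguerreCell hμ hx w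
    rw [← hsum, ← Finset.add_sum_erase _ _ (Finset.mem_univ i₀),
      ← Finset.add_sum_erase _ _ (Finset.mem_univ i₀),
      Finset.sum_congr rfl fun j hj => heq j (Finset.ne_of_mem_erase hj)] at h2
    rw [hi]
    linarith
  · exact heq i hi

end Laguerre

variable {d n : ℕ}

theorem discreteMeasure_apply (x : Fin n → EuclideanSpace ℝ (Fin d)) (lam : Fin n → ℝ)
    {s : Set (EuclideanSpace ℝ (Fin d))} (hs : MeasurableSet s) :
    discreteMeasure x lam s = ∑ i, ENNReal.ofReal (lam i) * s.indicator 1 (x i) := by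
  simp [discreteMeasure, Measure.dirac_apply' _ hs]

open Classical in
/-- Existence of the semidiscrete optimal transport map. -/
theorem IsAtomsWeights.exists_isBrenierMap {μ : Measure (EuclideanSpace ℝ (Fin d))}
    [IsProbabilityMeasure μ]
    (hμ : ∀ v : EuclideanSpace ℝ (Fin d), v ≠ 0 → ∀ c : ℝ, μ {z | inner ℝ v z = c} = 0)
    {x : Fin n → EuclideanSpace ℝ (Fin d)} {lam : Fin n → ℝ} (h : IsAtomsWeights x lam) :
    ∃ Q, IsBrenierMap μ (discreteMeasure x lam) Q := by
  have hn : NeZero n := ⟨by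
    rintro rfl
    simpa using h.weight_sum⟩
  obtain ⟨w, hw⟩ := exists_measure_laguerreCell_eq hμ h.atoms_injective h.weight_pos h.weight_sum
  let C := strictLaguerreCell x w
  have hC : ∀ i, MeasurableSet (C i) := fun i => (isOpen_strictLaguerreCell x w i).measurableSet
  let Q : EuclideanSpace ℝ (Fin d) → EuclideanSpace ℝ (Fin d) := fun z =>
    ∑ i, (C i).indicator (fun _ => x i) z
  have hne : (Finset.univ : Finset (Fin n)).Nonempty := Finset.univ_nonempty
  -- On the open set `C i` this maximum of affine functions is the one with slope `x i`, hence has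
  -- gradient `x i` there.
  let ψ : EuclideanSpace ℝ (Fin d) → ℝ := fun z =>
    Finset.univ.sup' hne fun i => inner ℝ (x i) z - w i
  have hQ : ∀ i, ∀ z ∈ C i, Q z = x i := by
    intro i z hz
    refine (Finset.sum_eq_single i (fun j _ hj => ?_) (by simp)).trans
      (Set.indicator_of_mem hz _)
    exact Set.indicator_of_notMem
      (Set.disjoint_left.1 (disjoint_strictLaguerreCell x w (Ne.symm hj)) hz) _
  have hψ : ∀ i, ∀ z ∈ C i, ψ z = inner ℝ (x i) z - w i := by
    intro i z hz
    refine le_antisymm (Finset.sup'_le _ _ fun j _ => strictLaguerreCell_subset x w i hz j) ?_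
    exact Finset.le_sup' (fun i => inner ℝ (x i) z - w i) (Finset.mem_univ i)
  have hae := ae_exists_mem_strictLaguerreCell hμ h.atoms_injective w
  have hQm : Measurable Q :=
    Finset.measurable_fun_sum _ fun i _ => measurable_const.indicator (hC i)
  refine ⟨Q, ⟨Set.univ, ψ, ⟨convex_univ, ?_⟩, ?_⟩, hQm, ?_⟩
  · intro a _ b _ s t hs ht hst
    refine Finset.sup'_le _ _ fun i _ => ?_
    have h1 : inner ℝ (x i) a - w i ≤ ψ a :=
      Finset.le_sup' (fun i => inner ℝ (x i) a - w i) (Finset.mem_univ i)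
    have h2 : inner ℝ (x i) b - w i ≤ ψ b :=
      Finset.le_sup' (fun i => inner ℝ (x i) b - w i) (Finset.mem_univ i)
    have h3 : inner ℝ (x i) (s • a + t • b) - w i =
        s * (inner ℝ (x i) a - w i) + t * (inner ℝ (x i) b - w i) := by
      rw [inner_add_right, inner_smul_right, inner_smul_right]
      linear_combination (-w i) * hst.symm
    rw [h3, smul_eq_mul, smul_eq_mul]
    gcongr
  · filter_upwards [hae] with z ⟨i, hz⟩
    refine ⟨by simp, ?_⟩
    rw [hQ i z hz]
    have h1 : HasGradientAt (fun z => inner ℝ (x i) z - w i) (x i) z := by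
      rw [hasGradientAt_iff_hasFDerivAt]
      have := ((innerSL ℝ (x i)).hasFDerivAt (x := z)).sub_const (w i)
      exact this
    refine h1.congr_of_eventuallyEq ?_
    filter_upwards [(isOpen_strictLaguerreCell x w i).mem_nhds hz] with z' hz'
    exact hψ i z' hz'
  · ext s hs
    rw [Measure.map_apply hQm hs, discreteMeasure_apply x lam hs]
    have h1 : μ (Q ⁻¹' s) = μ (⋃ i ∈ Finset.univ.filter fun i => x i ∈ s, C i) := by
      apply measure_congr
      filter_upwards [hae] with z ⟨i, hz⟩
      refine propext ?_
      change Q z ∈ s ↔ z ∈ ⋃ i ∈ Finset.univ.filter fun i => x i ∈ s, C i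
      rw [hQ i z hz]
      simp only [Finset.mem_filter, Finset.mem_univ, true_and, Set.mem_iUnion, exists_prop]
      refine ⟨fun hi => ⟨i, hi, hz⟩, fun ⟨j, hj, hjz⟩ => ?_⟩
      rwa [← hQ i z hz, hQ j z hjz]
    rw [h1, measure_biUnion_finset (fun i _ j _ h => disjoint_strictLaguerreCell x w h)
      fun i _ => hC i, Finset.sum_filter]
    refine Finset.sum_congr rfl fun i _ => ?_
    have h2 : μ (C i) = ENNReal.ofReal (lam i) := by
      rw [← hw i, ofReal_measureReal]
      exact measure_laguerreCell_eq hμ h.atoms_injective w i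
    rw [h2]
    by_cases his : x i ∈ s <;> simp [his]

end SemiDiscreteOT

end

/-! ### Halfspace depth and Tukey medians -/

namespace SemiDiscreteOT

variable {d : ℕ} {μ : Measure (EuclideanSpace ℝ (Fin d))}

theorem halfspaceDepth_le (μ : Measure (EuclideanSpace ℝ (Fin d)))
    {v : EuclideanSpace ℝ (Fin d)} (hv : v ≠ 0) (u : EuclideanSpace ℝ (Fin d)) :
    halfspaceDepth μ u ≤ μ {x | 0 ≤ inner ℝ v (x - u)} := by
  rw [measure_halfspace_sub, zero_add]
  exact iInf₂_le _ ⟨⟨v, _, hv, rfl⟩, le_refl (inner ℝ v u)⟩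

theorem nonempty_unit_sphere (hd : 1 ≤ d) :
    (Metric.sphere (0 : EuclideanSpace ℝ (Fin d)) 1).Nonempty := by
  have : NeZero d := ⟨by omega⟩
  exact ⟨EuclideanSpace.single 0 1, by simp⟩

/-- A halfspace containing `u` contains a parallel one with `u` on its boundary; the mass of the
latter is continuous in the unit normal, and the sphere is compact. -/
theorem exists_halfspaceDepth_eq [IsFiniteMeasure μ] (hd : 1 ≤ d)
    (hμ : ∀ v : EuclideanSpace ℝ (Fin d), v ≠ 0 → ∀ c : ℝ, μ {z | inner ℝ v z = c} = 0)
    (u : EuclideanSpace ℝ (Fin d)) :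
    ∃ v : EuclideanSpace ℝ (Fin d), ‖v‖ = 1 ∧
      halfspaceDepth μ u = μ {x | 0 ≤ inner ℝ v (x - u)} := by
  have hc : ContinuousOn (fun v : EuclideanSpace ℝ (Fin d) => μ {x | 0 ≤ inner ℝ v (x - u)})
      (Metric.sphere 0 1) := by
    intro v hv
    have hv0 : v ≠ 0 := ne_zero_of_mem_unit_sphere ⟨v, hv⟩
    have h1 := (tendsto_measure_cone hμ hv0 u).comp
      ((by fun_prop : Continuous fun v : EuclideanSpace ℝ (Fin d) => (v, u, (0 : ℝ))).tendsto v)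
    refine Tendsto.mono_left ?_ nhdsWithin_le_nhds
    simpa [Function.comp_def] using h1
  obtain ⟨v, hv, hmin⟩ := (isCompact_sphere _ _).exists_isMinOn (nonempty_unit_sphere hd) hc
  have hv1 : ‖v‖ = 1 := by simpa using hv
  refine ⟨v, hv1, le_antisymm (halfspaceDepth_le μ (norm_ne_zero_iff.1 (by simp [hv1])) u) ?_⟩
  refine le_iInf₂ ?_
  rintro H ⟨⟨w, c, hw, rfl⟩, hu⟩
  have hw' : ‖w‖⁻¹ • w ∈ Metric.sphere (0 : EuclideanSpace ℝ (Fin d)) 1 := by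
    simp [norm_smul, hw]
  refine (hmin hw').trans (measure_mono fun x hx => ?_)
  have hx : 0 ≤ inner ℝ (‖w‖⁻¹ • w) (x - u) := hx
  have hu : c ≤ inner ℝ w u := hu
  rw [inner_smul_left, inner_sub_right] at hx
  have h1 : 0 < ‖w‖⁻¹ := inv_pos.2 (norm_pos_iff.2 hw)
  have h2 := nonneg_of_mul_nonneg_right hx (by simpa using h1)
  exact (show c ≤ inner ℝ w x by linarith)

/-- The direction optimal at `u` bounds the depth at nearby points too, and the mass of its
halfspace varies continuously with the boundary point. -/
theorem upperSemicontinuous_halfspaceDepth [IsFiniteMeasure μ] (hd : 1 ≤ d)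
    (hμ : ∀ v : EuclideanSpace ℝ (Fin d), v ≠ 0 → ∀ c : ℝ, μ {z | inner ℝ v z = c} = 0) :
    UpperSemicontinuous (halfspaceDepth μ) := by
  intro u c hc
  obtain ⟨v, hv, huv⟩ := exists_halfspaceDepth_eq hd hμ u
  have hv0 : v ≠ 0 := norm_ne_zero_iff.1 (by simp [hv])
  have h1 := (tendsto_measure_cone hμ hv0 u).comp
    ((by fun_prop : Continuous fun u : EuclideanSpace ℝ (Fin d) => (v, u, (0 : ℝ))).tendsto u)
  rw [huv] at hc
  filter_upwards [h1.eventually_lt_const hc] with z hz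
  refine (halfspaceDepth_le μ hv0 z).trans_lt ?_
  simpa using hz

/-- Centerpoint theorem: every level below `1 / (d + 1)` is the depth of some point of the
support. -/
theorem exists_le_halfspaceDepth [IsProbabilityMeasure μ] (hd : 1 ≤ d)
    (hμ : ∀ v : EuclideanSpace ℝ (Fin d), v ≠ 0 → ∀ c : ℝ, μ {z | inner ℝ v z = c} = 0)
    (hconv : Convex ℝ μ.support) {t : ℝ} (ht0 : 0 ≤ t) (ht : t < 1 / ((d : ℝ) + 1)) :
    ∃ z ∈ μ.support, ENNReal.ofReal t ≤ halfspaceDepth μ z := by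
  have hd1 : (0 : ℝ) < (d : ℝ) + 1 := by positivity
  have hgap : 0 < 1 - ((d : ℝ) + 1) * t := by
    rw [lt_div_iff₀ hd1] at ht; linarith
  -- The ball misses so little mass that `d + 1` halfspaces of mass at most `t` cannot make up the
  -- rest.
  obtain ⟨r, hr⟩ : ∃ r : ℝ, μ.real {x | r ≤ ‖x‖} < 1 - ((d : ℝ) + 1) * t :=
    (((ENNReal.tendsto_toReal ENNReal.zero_ne_top).comp
      (tendsto_measure_setOf_le_atTop μ measurable_norm)).eventually_lt_const
      (by simpa using hgap)).exists
  let K := Metric.closedBall (0 : EuclideanSpace ℝ (Fin d)) r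
  let S := μ.support
  -- The sets for Helly's theorem are complements of light open halfspaces, cut down to the compact
  -- `S ∩ K`; the index `none` stands for `S ∩ K` itself.
  let ι := {p : EuclideanSpace ℝ (Fin d) × ℝ // μ.real {x | inner ℝ p.1 x < p.2} ≤ t}
  let F : Option ι → Set (EuclideanSpace ℝ (Fin d)) := fun o =>
    (S ∩ K) ∩ o.elim Set.univ fun p => {x | p.1.2 ≤ inner ℝ p.1.1 x}
  have hSc : IsClosed S := Measure.isClosed_support
  have hSK : IsCompact (S ∩ K) := (isCompact_closedBall _ _).inter_left hSc
  have hF : (⋂ o, F o).Nonempty := by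
    refine Convex.helly_theorem_compact' (𝕜 := ℝ) (fun o => ?_) (fun o => ?_) fun I hI => ?_
    · refine (hconv.inter (convex_closedBall _ _)).inter ?_
      cases o with
      | none => exact convex_univ
      | some p => exact convex_halfSpace_ge (innerSL ℝ p.1.1).toLinearMap.isLinear _
    · refine hSK.inter_right ?_
      cases o with
      | none => exact isClosed_univ
      | some p => exact isClosed_le (by fun_prop) (by fun_prop)
    · by_contra hne
      rw [Set.not_nonempty_iff_eq_empty] at hne
      have hcover : (Set.univ : Set (EuclideanSpace ℝ (Fin d))) ⊆
          Sᶜ ∪ {x | r ≤ ‖x‖} ∪ ⋃ o ∈ I, o.elim ∅ fun p : ι => {x | inner ℝ p.1.1 x < p.1.2} := by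
        intro x _
        by_contra hx
        simp only [Set.mem_union, not_or, Set.mem_iUnion, not_exists, Set.notMem_compl_iff] at hx
        obtain ⟨⟨hxS, hxr⟩, hxI⟩ := hx
        have hxK : x ∈ K := mem_closedBall_zero_iff.2 (not_le.1 hxr).le
        have : x ∈ ⋂ o ∈ I, F o := by
          refine Set.mem_iInter₂.2 fun o ho => ⟨⟨hxS, hxK⟩, ?_⟩
          have := hxI o ho
          cases o with
          | none => trivial
          | some p => exact not_lt.1 (show ¬ inner ℝ p.1.1 x < p.1.2 from this)
        rw [hne] at this
        exact this
      have h1 := measureReal_mono (μ := μ) hcover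
      rw [probReal_univ] at h1
      have h2 := measureReal_union_le (μ := μ) (Sᶜ ∪ {x | r ≤ ‖x‖})
        (⋃ o ∈ I, o.elim ∅ fun p : ι => {x | inner ℝ p.1.1 x < p.1.2})
      have h3 := measureReal_union_le (μ := μ) Sᶜ {x | r ≤ ‖x‖}
      have h4 : μ.real Sᶜ = 0 := by
        rw [measureReal_def, Measure.measure_compl_support, ENNReal.toReal_zero]
      have h5 := measureReal_biUnion_finset_le (μ := μ) I
        (fun o => o.elim ∅ fun p : ι => {x | inner ℝ p.1.1 x < p.1.2})
      have h6 : ∑ o ∈ I, μ.real (o.elim ∅ fun p : ι => {x | inner ℝ p.1.1 x < p.1.2}) ≤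
          I.card • t := by
        refine Finset.sum_le_card_nsmul _ _ _ fun o _ => ?_
        cases o with
        | none => simpa using ht0
        | some p => exact p.2
      have h7 : (I.card : ℝ) ≤ (d : ℝ) + 1 := by
        rw [finrank_euclideanSpace_fin] at hI
        exact_mod_cast hI
      rw [nsmul_eq_mul] at h6
      have h8 := mul_le_mul_of_nonneg_right h7 ht0
      linarith
  obtain ⟨z, hz⟩ := hF
  rw [Set.mem_iInter] at hz
  refine ⟨z, (hz none).1.1, not_lt.1 fun hlt => ?_⟩
  obtain ⟨v, hv, hzv⟩ := exists_halfspaceDepth_eq hd hμ z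
  have hv0 : v ≠ 0 := norm_ne_zero_iff.1 (by simp [hv])
  rw [hzv, measure_halfspace_sub, zero_add] at hlt
  -- A halfspace at `z` lighter than `t` stays so after a slight enlargement; its interior then
  -- contains `z` and belongs to the excluded family.
  obtain ⟨c, hc, hcz⟩ := (((tendsto_measure_halfspace hμ hv0 _).eventually_lt_const
    hlt).filter_mono nhdsWithin_le_nhds).and
      (self_mem_nhdsWithin (s := Set.Iio (inner ℝ v z))) |>.exists
  have hmem : μ.real {x | inner ℝ (-v) x < -c} ≤ t := by
    refine ENNReal.toReal_le_of_le_ofReal ht0 ((measure_mono fun x hx => ?_).trans hc.le)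
    simp only [inner_neg_left, neg_lt_neg_iff, Set.mem_ofPred_eq] at hx ⊢
    exact hx.le
  have h1 : -c ≤ inner ℝ (-v) z := (hz (some ⟨(-v, -c), hmem⟩)).2
  rw [inner_neg_left, neg_le_neg_iff] at h1
  exact not_lt.2 h1 hcz

theorem IsTukeyMedian.le_halfspaceDepth [IsProbabilityMeasure μ] (hd : 1 ≤ d)
    (hμ : ∀ v : EuclideanSpace ℝ (Fin d), v ≠ 0 → ∀ c : ℝ, μ {z | inner ℝ v z = c} = 0)
    (hconv : Convex ℝ μ.support) {u : EuclideanSpace ℝ (Fin d)} (hu : IsTukeyMedian μ u) :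
    ENNReal.ofReal (1 / ((d : ℝ) + 1)) ≤ halfspaceDepth μ u := by
  have hpos : 0 < 1 / ((d : ℝ) + 1) := by positivity
  have h1 : Tendsto ENNReal.ofReal (𝓝[<] (1 / ((d : ℝ) + 1)))
      (𝓝 (ENNReal.ofReal (1 / ((d : ℝ) + 1)))) :=
    (ENNReal.continuous_ofReal.tendsto _).mono_left nhdsWithin_le_nhds
  refine le_of_tendsto h1 ?_
  filter_upwards [Ioo_mem_nhdsLT hpos] with t ht
  obtain ⟨z, hz, hzt⟩ := exists_le_halfspaceDepth hd hμ hconv ht.1.le ht.2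
  exact hzt.trans (hu.2 z hz)

theorem exists_isTukeyMedian [IsProbabilityMeasure μ] (hd : 1 ≤ d)
    (hμ : ∀ v : EuclideanSpace ℝ (Fin d), v ≠ 0 → ∀ c : ℝ, μ {z | inner ℝ v z = c} = 0)
    (hconv : Convex ℝ μ.support) : ∃ u, IsTukeyMedian μ u := by
  have hpos : 0 < 1 / ((d : ℝ) + 1) := by positivity
  obtain ⟨t, ht0, ht⟩ := exists_between hpos
  obtain ⟨z₀, hz₀, hzt⟩ := exists_le_halfspaceDepth hd hμ hconv ht0.le ht
  obtain ⟨r, hr, hr0⟩ := (((tendsto_measure_setOf_le_atTop μ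
    (measurable_norm (α := EuclideanSpace ℝ (Fin d)))).eventually_lt_const
    (ENNReal.ofReal_pos.2 ht0)).and (eventually_ge_atTop 0)).exists
  -- The halfspace at `z` with normal `z` avoids the open ball of radius `‖z‖`, so depth is small
  -- far out and the maximization takes place on a compact set.
  have hout : ∀ z : EuclideanSpace ℝ (Fin d), r < ‖z‖ →
      halfspaceDepth μ z < ENNReal.ofReal t := by
    intro z hz
    have hz0 : z ≠ 0 := norm_pos_iff.1 (hr0.trans_lt hz)
    refine ((halfspaceDepth_le μ hz0 z).trans (measure_mono fun x hx => ?_)).trans_lt hr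
    have hx : 0 ≤ inner ℝ z (x - z) := hx
    rw [inner_sub_right, real_inner_self_eq_norm_sq] at hx
    have h1 := real_inner_le_norm z x
    have h2 : ‖z‖ * ‖z‖ ≤ ‖z‖ * ‖x‖ := by nlinarith
    exact hz.le.trans (le_of_mul_le_mul_left h2 (hr0.trans_lt hz))
  have hin : ∀ z, ENNReal.ofReal t ≤ halfspaceDepth μ z → z ∈ Metric.closedBall 0 r := by
    intro z hz
    rw [mem_closedBall_zero_iff]
    exact not_lt.1 fun h => not_lt.2 hz (hout z h)
  have hcpt : IsCompact (μ.support ∩ Metric.closedBall 0 r) :=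
    (isCompact_closedBall _ _).inter_left Measure.isClosed_support
  have hne : (μ.support ∩ Metric.closedBall 0 r).Nonempty := ⟨z₀, hz₀, hin z₀ hzt⟩
  obtain ⟨u, hu, hmax⟩ := UpperSemicontinuousOn.exists_isMaxOn hne hcpt
    ((upperSemicontinuous_halfspaceDepth hd hμ).upperSemicontinuousOn _)
  refine ⟨u, hu.1, fun z hz => ?_⟩
  by_cases hzt' : ENNReal.ofReal t ≤ halfspaceDepth μ z
  · exact hmax ⟨hz, hin z hzt'⟩
  · exact (not_le.1 hzt').le.trans (hzt.trans (hmax ⟨hz₀, hin z₀ hzt⟩))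

/-- A halfspace bounded by a hyperplane through the origin is a cone, so the two opposite halfspaces
at `θ` have equal mass; they overlap in a null set. -/
theorem AngularlySymmetric.measure_halfspace [IsProbabilityMeasure μ]
    (hμ : ∀ v : EuclideanSpace ℝ (Fin d), v ≠ 0 → ∀ c : ℝ, μ {z | inner ℝ v z = c} = 0)
    {θ : EuclideanSpace ℝ (Fin d)} (h : AngularlySymmetric μ θ) {v : EuclideanSpace ℝ (Fin d)}
    (hv : v ≠ 0) : μ {x | 0 ≤ inner ℝ v (x - θ)} = ENNReal.ofReal (1 / 2) := by
  let B : Set (EuclideanSpace ℝ (Fin d)) := {z | 0 ≤ inner ℝ v z}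
  have hB : MeasurableSet B := (isClosed_le (by fun_prop) (by fun_prop)).measurableSet
  have h1 := h B hB fun r hr => by
    ext z
    rw [Set.mem_image]
    constructor
    · rintro ⟨y, hy, rfl⟩
      change 0 ≤ inner ℝ v (r • y)
      rw [inner_smul_right]
      exact mul_nonneg hr.le hy
    · intro hz
      refine ⟨r⁻¹ • z, ?_, smul_inv_smul₀ hr.ne' z⟩
      change 0 ≤ inner ℝ v (r⁻¹ • z)
      rw [inner_smul_right]
      exact mul_nonneg (inv_pos.2 hr).le hz
  have h2 : (fun z => θ + z) '' B = {x | 0 ≤ inner ℝ v (x - θ)} := by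
    ext x
    simp only [Set.mem_image]
    exact ⟨fun ⟨y, hy, hx⟩ => by rw [← hx]; simpa using (show 0 ≤ inner ℝ v y from hy), fun hx => ⟨x - θ, hx, by simp⟩⟩
  have h3 : (fun z => θ - z) '' B = {x | inner ℝ v (x - θ) ≤ 0} := by
    ext x
    simp only [Set.mem_image]
    refine ⟨fun ⟨y, hy, hx⟩ => by
      rw [← hx]; simpa [inner_neg_right] using (show 0 ≤ inner ℝ v y from hy),
      fun hx => ⟨θ - x, ?_, by simp⟩⟩
    rw [← neg_sub]
    change 0 ≤ inner ℝ v (-(x - θ))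
    rw [inner_neg_right]
    exact neg_nonneg.2 hx
  rw [h2, h3] at h1
  have h4 : μ {x | inner ℝ v (x - θ) < 0} = μ {x | inner ℝ v (x - θ) ≤ 0} := by
    apply measure_congr
    have h0 : ∀ᵐ x ∂μ, inner ℝ v x ≠ inner ℝ v θ := by
      rw [ae_iff]; simpa using hμ v hv _
    filter_upwards [h0] with x hx
    have hx' : inner ℝ v (x - θ) ≠ 0 := by rw [inner_sub_right]; exact sub_ne_zero.2 hx
    exact propext ⟨le_of_lt, fun h => lt_of_le_of_ne h hx'⟩
  have h5 : {x | 0 ≤ inner ℝ v (x - θ)}ᶜ = {x | inner ℝ v (x - θ) < 0} := by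
    ext x; simp
  have hm : MeasurableSet {x : EuclideanSpace ℝ (Fin d) | 0 ≤ inner ℝ v (x - θ)} :=
    (isClosed_le (by fun_prop) (by fun_prop)).measurableSet
  have h6 := probReal_compl_eq_one_sub (μ := μ) hm
  rw [h5, measureReal_def, h4, h1, ← measureReal_def] at h6
  rw [← ofReal_measureReal]
  congr 1
  linarith

theorem AngularlySymmetric.halfspaceDepth_eq [IsProbabilityMeasure μ] (hd : 1 ≤ d)
    (hμ : ∀ v : EuclideanSpace ℝ (Fin d), v ≠ 0 → ∀ c : ℝ, μ {z | inner ℝ v z = c} = 0)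
    {θ : EuclideanSpace ℝ (Fin d)} (h : AngularlySymmetric μ θ) :
    halfspaceDepth μ θ = ENNReal.ofReal (1 / 2) := by
  obtain ⟨v, hv, hvθ⟩ := exists_halfspaceDepth_eq hd hμ θ
  rw [hvθ]
  exact h.measure_halfspace hμ (norm_ne_zero_iff.1 (by simp [hv]))

/-- Every ball about a point of the support carries mass. -/
theorem measure_pos_of_mem_support_of_isOpen {s : Set (EuclideanSpace ℝ (Fin d))}
    {z : EuclideanSpace ℝ (Fin d)} (hz : z ∈ μ.support) (hs : IsOpen s) (hzs : z ∈ s) :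
    0 < μ s :=
  (Measure.mem_support_iff_forall z).1 hz s (hs.mem_nhds hzs)

/-- A point off the closed convex support is strictly separated from it, hence lies in a null
halfspace. -/
theorem mem_support_of_halfspaceDepth_pos (hconv : Convex ℝ μ.support)
    {u : EuclideanSpace ℝ (Fin d)} (hu : 0 < halfspaceDepth μ u) (hμ0 : μ ≠ 0) :
    u ∈ μ.support := by
  by_contra hnot
  obtain ⟨f, c, hfu, hf⟩ := geometric_hahn_banach_point_closed hconv Measure.isClosed_support hnot
  obtain ⟨s, hs⟩ := Measure.nonempty_support hμ0
  let v := (InnerProductSpace.toDual ℝ (EuclideanSpace ℝ (Fin d))).symm f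
  have hv : ∀ z, inner ℝ v z = f z := fun z => InnerProductSpace.toDual_symm_apply
  have hv0 : -v ≠ 0 := by
    rw [neg_ne_zero]
    intro h
    have h1 := hf s hs
    rw [← hv, h, inner_zero_left] at h1 hfu
    exact lt_asymm h1 hfu
  have h1 := hu.trans_le (halfspaceDepth_le μ hv0 u)
  refine h1.ne' (measure_mono_null ?_ (Measure.measure_compl_support (μ := μ)))
  intro x hx hxS
  have h2 := hf x hxS
  have hx : 0 ≤ inner ℝ (-v) (x - u) := hx
  rw [inner_neg_left, inner_sub_right, hv, hv] at hx
  linarith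

theorem AngularlySymmetric.isTukeyMedian_iff [IsProbabilityMeasure μ] (hd : 1 ≤ d)
    (hμ : ∀ v : EuclideanSpace ℝ (Fin d), v ≠ 0 → ∀ c : ℝ, μ {z | inner ℝ v z = c} = 0)
    (hconv : Convex ℝ μ.support) {θ : EuclideanSpace ℝ (Fin d)} (h : AngularlySymmetric μ θ)
    (u : EuclideanSpace ℝ (Fin d)) : IsTukeyMedian μ u ↔ u = θ := by
  have hθ := h.halfspaceDepth_eq hd hμ
  have hθS : θ ∈ μ.support :=
    mem_support_of_halfspaceDepth_pos hconv (by rw [hθ]; simp) (IsProbabilityMeasure.ne_zero μ)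
  -- With normal `u - θ`, the halfspace at `u` lies in the one at `θ`. The open slab between them
  -- contains the midpoint, a point of the convex support, so it has positive mass.
  have key : ∀ u ∈ μ.support, u ≠ θ → halfspaceDepth μ u < halfspaceDepth μ θ := by
    intro u hu hne
    have hv : u - θ ≠ 0 := sub_ne_zero.2 hne
    refine (halfspaceDepth_le μ hv u).trans_lt ?_
    rw [hθ, ← h.measure_halfspace hμ hv]
    let s : Set (EuclideanSpace ℝ (Fin d)) :=
      {x | 0 < inner ℝ (u - θ) (x - θ)} ∩ {x | inner ℝ (u - θ) (x - u) < 0}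
    have hs : IsOpen s :=
      (isOpen_lt (by fun_prop) (by fun_prop)).inter (isOpen_lt (by fun_prop) (by fun_prop))
    have hpos : 0 < inner ℝ (u - θ) (u - θ) := real_inner_self_pos.2 hv
    have hmid : midpoint ℝ θ u ∈ s := by
      have e1 : midpoint ℝ θ u - θ = (2⁻¹ : ℝ) • (u - θ) := by
        rw [midpoint_sub_left]; simp
      have e2 : midpoint ℝ θ u - u = -((2⁻¹ : ℝ) • (u - θ)) := by
        rw [midpoint_sub_right, ← neg_sub u θ, smul_neg]; simp
      constructor
      · change 0 < inner ℝ (u - θ) (midpoint ℝ θ u - θ)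
        rw [e1, inner_smul_right]
        positivity
      · change inner ℝ (u - θ) (midpoint ℝ θ u - u) < 0
        rw [e2, inner_neg_right, inner_smul_right, neg_lt_zero]
        positivity
    have hspos := measure_pos_of_mem_support_of_isOpen
      (hconv.midpoint_mem hθS hu) hs hmid
    have hdisj : Disjoint {x | 0 ≤ inner ℝ (u - θ) (x - u)} s := by
      rw [Set.disjoint_left]
      exact fun x hx hxs => not_lt.2 (show 0 ≤ inner ℝ (u - θ) (x - u) from hx) hxs.2
    refine lt_of_lt_of_le ?_ (measure_mono (μ := μ)
      (s := {x | 0 ≤ inner ℝ (u - θ) (x - u)} ∪ s) ?_)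
    · rw [measure_union hdisj hs.measurableSet]
      exact ENNReal.lt_add_right (measure_ne_top _ _) hspos.ne'
    · rintro x (hx | hx)
      · have hx : 0 ≤ inner ℝ (u - θ) (x - u) := hx
        change 0 ≤ inner ℝ (u - θ) (x - θ)
        rw [show x - θ = (x - u) + (u - θ) by abel, inner_add_right]
        linarith
      · exact (show 0 < inner ℝ (u - θ) (x - θ) from hx.1).le
  constructor
  · intro hu
    by_contra hne
    exact not_lt.2 (hu.2 θ hθS) (key u hu.1 hne)
  · rintro rfl
    refine ⟨hθS, fun z hz => ?_⟩
    by_cases hz' : z = u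
    · rw [hz']
    · exact (key z hz hz').le

end SemiDiscreteOT

/-! ### Breakdown is equivalent to contaminating at least the depth -/

namespace SemiDiscreteOT

variable {d n : ℕ} {μ : Measure (EuclideanSpace ℝ (Fin d))}
  {x : Fin n → EuclideanSpace ℝ (Fin d)} {lam : Fin n → ℝ}

theorem IsAtomsWeights.discreteMeasure_singleton (h : IsAtomsWeights x lam) (i : Fin n) :
    discreteMeasure x lam {x i} = ENNReal.ofReal (lam i) := by
  rw [discreteMeasure_apply x lam (measurableSet_singleton _), Finset.sum_eq_single i]
  · simp
  · intro j _ hj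
    rw [Set.indicator_of_notMem (by simpa using fun h' => hj (h.atoms_injective h')), mul_zero]
  · simp

theorem IsAtomsWeights.discreteMeasure_mem_contaminations (h : IsAtomsWeights x lam)
    (I : Finset (Fin n)) : discreteMeasure x lam ∈ contaminations x lam I :=
  ⟨⟨n, x, lam, h, rfl⟩, fun i _ => h.discreteMeasure_singleton i⟩

theorem otMap_isBrenierMap_or_eq_zero (μ ν : Measure (EuclideanSpace ℝ (Fin d))) :
    IsBrenierMap μ ν (otMap μ ν) ∨ otMap μ ν = 0 := by
  unfold otMap
  split_ifs with h
  · exact Or.inl h.choose_spec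
  · exact Or.inr rfl

theorem IsAtomsWeights.isBrenierMap_otMap [IsProbabilityMeasure μ]
    (hμ : ∀ v : EuclideanSpace ℝ (Fin d), v ≠ 0 → ∀ c : ℝ, μ {z | inner ℝ v z = c} = 0)
    (h : IsAtomsWeights x lam) :
    IsBrenierMap μ (discreteMeasure x lam) (otMap μ (discreteMeasure x lam)) := by
  have hex := h.exists_isBrenierMap hμ
  rw [otMap, dif_pos hex]
  exact hex.choose_spec

/-- Outside of the uncontaminated atoms a contaminated measure has mass `∑ i ∈ I, lam i`. -/
theorem measure_compl_atoms (h : IsAtomsWeights x lam) {I : Finset (Fin n)}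
    {ν : Measure (EuclideanSpace ℝ (Fin d))} [IsProbabilityMeasure ν]
    (hν : ∀ i, i ∉ I → ν {x i} = ENNReal.ofReal (lam i)) :
    ν (x '' {i | i ∉ I})ᶜ = ENNReal.ofReal (∑ i ∈ I, lam i) := by
  have hset : x '' {i | i ∉ I} = ⋃ i ∈ Iᶜ, {x i} := by
    ext z; simp [eq_comm]
  have h1 : ν (x '' {i | i ∉ I}) = ENNReal.ofReal (∑ i ∈ Iᶜ, lam i) := by
    rw [hset, measure_biUnion_finset _ fun i _ => measurableSet_singleton _,
      ENNReal.ofReal_sum_of_nonneg fun i _ => (h.weight_pos i).le]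
    · exact Finset.sum_congr rfl fun i hi => hν i (Finset.mem_compl.1 hi)
    · intro i _ j _ hij
      simpa using fun h' => hij (h.atoms_injective h')
  rw [prob_compl_eq_one_sub (Set.toFinite _).measurableSet, h1, ← ENNReal.ofReal_one,
    ← ENNReal.ofReal_sub _ (Finset.sum_nonneg fun i _ => (h.weight_pos i).le)]
  congr 1
  rw [← h.weight_sum, ← Finset.sum_add_sum_compl I lam]
  ring

theorem IsBrenierMap.isProbabilityMeasure [IsProbabilityMeasure μ]
    {ν : Measure (EuclideanSpace ℝ (Fin d))}
    {Q : EuclideanSpace ℝ (Fin d) → EuclideanSpace ℝ (Fin d)} (h : IsBrenierMap μ ν Q) :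
    IsProbabilityMeasure ν := by
  rw [← h.2.2]
  exact Measure.isProbabilityMeasure_map h.2.1.aemeasurable

/-- Near a point of depth above `t`, all sufficiently wide cones have mass above `t`. -/
theorem exists_lt_measure_cone [IsFiniteMeasure μ]
    (hμ : ∀ v : EuclideanSpace ℝ (Fin d), v ≠ 0 → ∀ c : ℝ, μ {z | inner ℝ v z = c} = 0)
    {u : EuclideanSpace ℝ (Fin d)} {t : ℝ≥0∞} (ht : t < halfspaceDepth μ u) :
    ∃ δ > 0, ∃ η > 0, ∀ v : EuclideanSpace ℝ (Fin d), ‖v‖ = 1 → ∀ z ∈ Metric.ball u δ,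
      t < μ {y | η * ‖y - z‖ ≤ inner ℝ v (y - z)} := by
  -- Compactness of the sphere turns continuity of the cone mass at each direction into one
  -- neighbourhood serving all directions.
  have h1 : ∀ᶠ q : EuclideanSpace ℝ (Fin d) × ℝ in 𝓝 (u, 0),
      ∀ v ∈ Metric.sphere (0 : EuclideanSpace ℝ (Fin d)) 1,
        t < μ {y | q.2 * ‖y - q.1‖ ≤ inner ℝ v (y - q.1)} := by
    refine (isCompact_sphere _ _).eventually_forall_of_forall_eventually fun v hv => ?_
    have hv0 : v ≠ 0 := ne_zero_of_mem_unit_sphere ⟨v, hv⟩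
    have h2 := (tendsto_measure_cone hμ hv0 u).eventually_const_lt
      (ht.trans_le (halfspaceDepth_le μ hv0 u))
    have h3 : Tendsto (fun p : (EuclideanSpace ℝ (Fin d) × ℝ) × EuclideanSpace ℝ (Fin d) =>
        (p.2, p.1.1, p.1.2)) (𝓝 ((u, 0), v)) (𝓝 (v, u, 0)) :=
      (by fun_prop : Continuous fun p : (EuclideanSpace ℝ (Fin d) × ℝ) ×
        EuclideanSpace ℝ (Fin d) => (p.2, p.1.1, p.1.2)).tendsto _
    exact h3.eventually h2
  rw [nhds_prod_eq] at h1
  obtain ⟨pa, hpa, pb, hpb, hp⟩ := eventually_prod_iff.1 h1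
  obtain ⟨δ, hδ, hball⟩ := Metric.eventually_nhds_iff_ball.1 hpa
  obtain ⟨η, hη, hη0⟩ := ((hpb.filter_mono nhdsWithin_le_nhds).and
      (self_mem_nhdsWithin (s := Set.Ioi (0 : ℝ)))).exists
  exact ⟨δ, hδ, η, hη0, fun v hv z hz => hp (hball z hz) hη v (by simpa using hv)⟩

/-- Below the depth of `u`, the transport maps to contaminated targets are uniformly bounded
near `u`. -/
theorem exists_ae_norm_otMap_le [IsProbabilityMeasure μ]
    (hμ : ∀ v : EuclideanSpace ℝ (Fin d), v ≠ 0 → ∀ c : ℝ, μ {z | inner ℝ v z = c} = 0)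
    (h : IsAtomsWeights x lam) {u : EuclideanSpace ℝ (Fin d)} {I : Finset (Fin n)}
    (hI : ENNReal.ofReal (∑ i ∈ I, lam i) < halfspaceDepth μ u) :
    ∃ δ > 0, ∃ R : ℝ, ∀ ν ∈ contaminations x lam I,
      ∀ᵐ z ∂μ, z ∈ Metric.ball u δ → ‖otMap μ ν z‖ ≤ R := by
  obtain ⟨δ, hδ, η, hη, hcone⟩ := exists_lt_measure_cone hμ hI
  let M := ∑ i, ‖x i‖
  have hM0 : 0 ≤ M := Finset.sum_nonneg fun i _ => norm_nonneg _
  have hM : ∀ i, ‖x i‖ ≤ M := fun i =>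
    Finset.single_le_sum (f := fun i => ‖x i‖) (fun i _ => norm_nonneg _) (Finset.mem_univ i)
  have hMη : 0 ≤ M / η := by positivity
  -- A value longer than `M` is no uncontaminated atom; one longer than `M / η` overpowers all of
  -- them on the cone of aperture `η`.
  refine ⟨δ, hδ, M + M / η, fun ν hν => ?_⟩
  rcases otMap_isBrenierMap_or_eq_zero μ ν with hT | hT
  swap
  · rw [hT]
    exact Eventually.of_forall fun z _ => by
      rw [Pi.zero_apply, norm_zero]; positivity
  set T := otMap μ ν
  have := hT.isProbabilityMeasure
  obtain ⟨G, hG, hmono⟩ := hT.exists_monotone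
  filter_upwards [hG] with z hzG hz
  by_contra! hlt
  set r := ‖T z‖
  have hr : 0 < r := by linarith
  have hv : ‖r⁻¹ • T z‖ = 1 := by
    rw [norm_smul, norm_inv, Real.norm_of_nonneg hr.le]
    exact inv_mul_cancel₀ hr.ne'
  have h1 := hcone _ hv z hz
  have hmeas : MeasurableSet (x '' {i | i ∉ I})ᶜ := (Set.toFinite _).measurableSet.compl
  have h2 := measure_compl_atoms h hν.2
  rw [← hT.2.2, Measure.map_apply hT.2.1 hmeas] at h2
  rw [← h2] at h1
  -- If some `y` of the cone went to an atom `x i` with `i ∉ I`, monotonicity would give `r * η * ‖y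
  -- - z‖ ≤ M * ‖y - z‖`. So almost all of the cone goes to the contaminated part, which is too
  -- light for it.
  refine not_le.2 h1 (measure_mono_ae ?_)
  filter_upwards [hG] with y hyG hy
  rintro ⟨i, -, hi⟩
  have hy : η * ‖y - z‖ ≤ inner ℝ (r⁻¹ • T z) (y - z) := hy
  rw [real_inner_smul_left] at hy
  have h3 : r * (η * ‖y - z‖) ≤ inner ℝ (T z) (y - z) := by
    have := mul_le_mul_of_nonneg_left hy hr.le
    rwa [mul_inv_cancel_left₀ hr.ne'] at this
  have h4 := hmono y hyG z hzG
  rw [inner_sub_left, ← hi] at h4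
  have h5 := (real_inner_le_norm (x i) (y - z)).trans
    (mul_le_mul_of_nonneg_right (hM i) (norm_nonneg _))
  have hne : y ≠ z := by
    rintro rfl
    have h6 : r = ‖x i‖ := by rw [hi]
    linarith [hM i]
  have h7 : 0 < ‖y - z‖ := norm_pos_iff.2 (sub_ne_zero.2 hne)
  have h8 : M < r * η := by
    rw [← div_lt_iff₀ hη]; linarith
  have h9 := mul_lt_mul_of_pos_right h8 h7
  linarith

theorem BreaksDown.halfspaceDepth_le [IsProbabilityMeasure μ]
    (hμ : ∀ v : EuclideanSpace ℝ (Fin d), v ≠ 0 → ∀ c : ℝ, μ {z | inner ℝ v z = c} = 0)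
    (h : IsAtomsWeights x lam) {u : EuclideanSpace ℝ (Fin d)} {I : Finset (Fin n)}
    (hb : BreaksDown μ x lam u I) :
    halfspaceDepth μ u ≤ ENNReal.ofReal (∑ i ∈ I, lam i) := by
  by_contra! hI
  obtain ⟨δ, hδ, R, hR⟩ := exists_ae_norm_otMap_le hμ h hI
  have h1 : (⨆ ν' ∈ contaminations x lam I, ∫⁻ z in Metric.ball u δ,
      ‖otMap μ (discreteMeasure x lam) z - otMap μ ν' z‖ₑ ∂μ) ≤ ENNReal.ofReal (R + R) := by
    refine iSup₂_le fun ν' hν' => ?_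
    calc _ ≤ ∫⁻ z in Metric.ball u δ, ENNReal.ofReal (R + R) ∂μ := by
          refine setLIntegral_mono_ae measurable_const.aemeasurable ?_
          filter_upwards [hR _ (h.discreteMeasure_mem_contaminations I), hR ν' hν'] with z h1 h2 hz
          rw [← ofReal_norm]
          exact ENNReal.ofReal_le_ofReal ((norm_sub_le _ _).trans (add_le_add (h1 hz) (h2 hz)))
      _ = ENNReal.ofReal (R + R) * μ (Metric.ball u δ) := setLIntegral_const _ _
      _ ≤ ENNReal.ofReal (R + R) * 1 := by gcongr; exact prob_le_one
      _ = _ := mul_one _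
  rw [hb δ hδ, top_le_iff] at h1
  exact ENNReal.ofReal_ne_top h1

/-- Contaminating atoms sent far away in the direction `v`. -/
def farAtoms (x : Fin n → EuclideanSpace ℝ (Fin d)) (I : Finset (Fin n))
    (v : EuclideanSpace ℝ (Fin d)) (R : ℝ) (i : Fin n) : EuclideanSpace ℝ (Fin d) :=
  if i ∈ I then (R + (i : ℝ)) • v else x i

theorem norm_farAtoms_of_mem {I : Finset (Fin n)} {v : EuclideanSpace ℝ (Fin d)} (hv : ‖v‖ = 1)
    {R : ℝ} (hR : 0 ≤ R) {i : Fin n} (hi : i ∈ I) : ‖farAtoms x I v R i‖ = R + (i : ℝ) := by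
  rw [farAtoms, if_pos hi, norm_smul, hv, mul_one, Real.norm_of_nonneg (by positivity)]

/-- The offsets `i` give the moved atoms distinct norms, and `R` exceeds the norms of all the
original ones. -/
theorem IsAtomsWeights.farAtoms (h : IsAtomsWeights x lam) (I : Finset (Fin n))
    {v : EuclideanSpace ℝ (Fin d)} (hv : ‖v‖ = 1) {R : ℝ} (hR0 : 0 ≤ R) (hR : ∀ i, ‖x i‖ < R) :
    IsAtomsWeights (farAtoms x I v R) lam := by
  refine ⟨fun i j hij => ?_, h.weight_pos, h.weight_sum⟩
  have hij' := congrArg norm hij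
  by_cases hi : i ∈ I <;> by_cases hj : j ∈ I
  · rw [norm_farAtoms_of_mem hv hR0 hi, norm_farAtoms_of_mem hv hR0 hj, add_right_inj] at hij'
    exact Fin.ext (by exact_mod_cast hij')
  · rw [norm_farAtoms_of_mem hv hR0 hi, SemiDiscreteOT.farAtoms, if_neg hj] at hij'
    linarith [hR j, (Nat.cast_nonneg (i : ℕ) : (0 : ℝ) ≤ _)]
  · rw [norm_farAtoms_of_mem hv hR0 hj, SemiDiscreteOT.farAtoms, if_neg hi] at hij'
    linarith [hR i, (Nat.cast_nonneg (j : ℕ) : (0 : ℝ) ≤ _)]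
  · rw [SemiDiscreteOT.farAtoms, SemiDiscreteOT.farAtoms, if_neg hi, if_neg hj] at hij
    exact h.atoms_injective hij

theorem IsAtomsWeights.farAtoms_mem_contaminations (h : IsAtomsWeights x lam)
    (I : Finset (Fin n)) {v : EuclideanSpace ℝ (Fin d)} (hv : ‖v‖ = 1) {R : ℝ} (hR0 : 0 ≤ R)
    (hR : ∀ i, ‖x i‖ < R) :
    discreteMeasure (SemiDiscreteOT.farAtoms x I v R) lam ∈ contaminations x lam I := by
  have hf := h.farAtoms I hv hR0 hR
  refine ⟨⟨n, _, lam, hf, rfl⟩, fun i hi => ?_⟩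
  have := hf.discreteMeasure_singleton i
  rwa [SemiDiscreteOT.farAtoms, if_neg hi] at this

theorem IsBrenierMap.ae_exists_eq {T : EuclideanSpace ℝ (Fin d) → EuclideanSpace ℝ (Fin d)}
    (hT : IsBrenierMap μ (discreteMeasure x lam) T) : ∀ᵐ z ∂μ, ∃ i, T z = x i := by
  have hm : MeasurableSet (Set.range x)ᶜ := (Set.finite_range x).measurableSet.compl
  have h1 : discreteMeasure x lam (Set.range x)ᶜ = 0 := by
    rw [discreteMeasure_apply x lam hm]
    simp
  rw [← hT.2.2, Measure.map_apply hT.2.1 hm] at h1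
  filter_upwards [measure_eq_zero_iff_ae_notMem.1 h1] with z hz
  simpa [eq_comm] using hz

/-- If the halfspace at level `t` carries less than the contaminating mass, far contaminating atoms
attract almost every point of the ball above level `t + η`. -/
theorem ae_le_norm_otMap_farAtoms [IsProbabilityMeasure μ]
    (hμ : ∀ v : EuclideanSpace ℝ (Fin d), v ≠ 0 → ∀ c : ℝ, μ {z | inner ℝ v z = c} = 0)
    (h : IsAtomsWeights x lam) {u v : EuclideanSpace ℝ (Fin d)} {I : Finset (Fin n)}
    (hv : ‖v‖ = 1) {δ t η M L R : ℝ} (hη : 0 < η) (hM0 : 0 ≤ M) (hM : ∀ i, ‖x i‖ ≤ M)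
    (hL : μ {z | t ≤ inner ℝ v (z - u)} + μ {z | L ≤ ‖z - u‖} <
      ENNReal.ofReal (∑ i ∈ I, lam i))
    (hMR : M < R) (hR : M * (L + δ) / η ≤ R) :
    ∀ᵐ z ∂μ, z ∈ Metric.ball u δ ∩ {z | t + η < inner ℝ v (z - u)} →
      R ≤ ‖otMap μ (discreteMeasure (farAtoms x I v R) lam) z‖ := by
  have hR0 : 0 < R := hM0.trans_lt hMR
  have hf := h.farAtoms I hv hR0.le fun i => (hM i).trans_lt hMR
  have hT := hf.isBrenierMap_otMap hμ
  set T := otMap μ (discreteMeasure (farAtoms x I v R) lam)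
  obtain ⟨G, hG, hmono⟩ := hT.exists_monotone
  have hatoms := hT.ae_exists_eq
  by_contra hnot
  -- A single bad point `b`, necessarily sent to an uncontaminated atom, suffices: by monotonicity
  -- all mass sent to moved atoms then lies above level `t` or at distance at least `L` from `u`,
  -- which is too little.
  obtain ⟨b, hb, hbG, i, hbi⟩ :=
    ((not_eventually.1 hnot).and_eventually (hG.and hatoms)).exists
  push Not at hb
  obtain ⟨hbB, hbR⟩ := hb
  have hiI : i ∉ I := by
    intro hi
    rw [hbi, norm_farAtoms_of_mem hv hR0.le hi] at hbR
    linarith [(Nat.cast_nonneg (i : ℕ) : (0 : ℝ) ≤ _)]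
  have hbi' : T b = x i := by rw [hbi, farAtoms, if_neg hiI]
  have := hT.isProbabilityMeasure
  have hmass := measure_compl_atoms h
    (h.farAtoms_mem_contaminations I hv hR0.le fun i => (hM i).trans_lt hMR).2
  have hmeas : MeasurableSet (x '' {i | i ∉ I})ᶜ := (Set.toFinite _).measurableSet.compl
  rw [← hT.2.2, Measure.map_apply hT.2.1 hmeas] at hmass
  rw [← hmass] at hL
  refine not_le.2 hL ((measure_mono_ae ?_).trans (measure_union_le _ _))
  filter_upwards [hG, hatoms] with a haG ⟨j, haj⟩ ha
  by_contra hcon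
  have hcon1 : inner ℝ v (a - u) < t := not_le.1 fun h' => hcon (Or.inl h')
  have hcon2 : ‖a - u‖ < L := not_le.1 fun h' => hcon (Or.inr h')
  have hjI : j ∈ I := by
    by_contra hj
    exact ha ⟨j, hj, by rw [haj, farAtoms, if_neg hj]⟩
  have h1 := hmono a haG b hbG
  rw [haj, hbi', farAtoms, if_pos hjI, inner_sub_left, real_inner_smul_left] at h1
  have hab : ‖a - b‖ ≤ L + δ := by
    have hbu : ‖b - u‖ < δ := by simpa [dist_eq_norm] using hbB.1
    have := norm_sub_le (a - u) (b - u)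
    rw [sub_sub_sub_cancel_right] at this
    linarith
  have h2 : -(M * (L + δ)) ≤ inner ℝ (x i) (a - b) := by
    have h3 := neg_le_of_abs_le (abs_real_inner_le_norm (x i) (a - b))
    have h4 : ‖x i‖ * ‖a - b‖ ≤ M * (L + δ) := by
      exact mul_le_mul (hM i) hab (norm_nonneg _) hM0
    linarith
  have h3 : inner ℝ v (a - b) < -η := by
    have hbt : t + η < inner ℝ v (b - u) := hbB.2
    have : inner ℝ v (a - b) = inner ℝ v (a - u) - inner ℝ v (b - u) := by
      rw [← inner_sub_right, sub_sub_sub_cancel_right]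
    linarith
  have h4 : (R + (j : ℝ)) * inner ℝ v (a - b) < (R + (j : ℝ)) * -η :=
    mul_lt_mul_of_pos_left h3 (by positivity)
  have h5 : (0 : ℝ) ≤ (j : ℝ) * η := by positivity
  rw [div_le_iff₀ hη] at hR
  linarith

theorem iSup_lintegral_otMap_eq_top [IsProbabilityMeasure μ]
    (hμ : ∀ v : EuclideanSpace ℝ (Fin d), v ≠ 0 → ∀ c : ℝ, μ {z | inner ℝ v z = c} = 0)
    (h : IsAtomsWeights x lam) {u v : EuclideanSpace ℝ (Fin d)} {I : Finset (Fin n)}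
    (hv : ‖v‖ = 1) {δ t η : ℝ} (hη : 0 < η)
    (hpos : μ (Metric.ball u δ ∩ {z | t + η < inner ℝ v (z - u)}) ≠ 0)
    (hlt : μ {z | t ≤ inner ℝ v (z - u)} < ENNReal.ofReal (∑ i ∈ I, lam i)) :
    (⨆ ν' ∈ contaminations x lam I,
      ∫⁻ z in Metric.ball u δ, ‖otMap μ (discreteMeasure x lam) z - otMap μ ν' z‖ₑ ∂μ) = ∞ := by
  set B := Metric.ball u δ ∩ {z | t + η < inner ℝ v (z - u)} with hBdef
  have hB : MeasurableSet B :=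
    (Metric.isOpen_ball.inter (isOpen_lt (by fun_prop) (by fun_prop))).measurableSet
  let M := ∑ i, ‖x i‖
  have hM0 : 0 ≤ M := Finset.sum_nonneg fun i _ => norm_nonneg _
  have hM : ∀ i, ‖x i‖ ≤ M := fun i =>
    Finset.single_le_sum (f := fun i => ‖x i‖) (fun i _ => norm_nonneg _) (Finset.mem_univ i)
  -- The gap in `hlt` absorbs the mass far from `u`, for which the monotonicity estimate is not
  -- uniform.
  obtain ⟨L, hL⟩ : ∃ L : ℝ, μ {z | t ≤ inner ℝ v (z - u)} + μ {z | L ≤ ‖z - u‖} <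
      ENNReal.ofReal (∑ i ∈ I, lam i) := by
    have h1 := (tendsto_measure_setOf_le_atTop μ
      (f := fun z : EuclideanSpace ℝ (Fin d) => ‖z - u‖)
      (by fun_prop : Continuous _).measurable).const_add (μ {z | t ≤ inner ℝ v (z - u)})
    rw [add_zero] at h1
    exact (h1.eventually_lt_const hlt).exists
  have key : ∀ R : ℝ, M < R → M * (L + δ) / η ≤ R →
      ∀ᵐ z ∂μ, z ∈ B → R ≤ ‖otMap μ (discreteMeasure (farAtoms x I v R) lam) z‖ :=
    fun R hMR hR => ae_le_norm_otMap_farAtoms hμ h hv hη hM0 hM hL hMR hR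
  have hQ : ∀ᵐ z ∂μ, ‖otMap μ (discreteMeasure x lam) z‖ ≤ M := by
    filter_upwards [(h.isBrenierMap_otMap hμ).ae_exists_eq] with z ⟨i, hi⟩
    rw [hi]
    exact hM i
  have hbound : ∀ᶠ R : ℝ in atTop, ENNReal.ofReal (R - M) * μ B ≤
      ⨆ ν' ∈ contaminations x lam I,
        ∫⁻ z in Metric.ball u δ, ‖otMap μ (discreteMeasure x lam) z - otMap μ ν' z‖ₑ ∂μ := by
    filter_upwards [eventually_gt_atTop M, eventually_ge_atTop (M * (L + δ) / η)] with R h1 h2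
    refine le_iSup₂_of_le _ (h.farAtoms_mem_contaminations I hv (hM0.trans h1.le)
      fun i => (hM i).trans_lt h1) ?_
    calc ENNReal.ofReal (R - M) * μ B = ∫⁻ _ in B, ENNReal.ofReal (R - M) ∂μ :=
          (setLIntegral_const _ _).symm
      _ ≤ ∫⁻ z in B, ‖otMap μ (discreteMeasure x lam) z -
            otMap μ (discreteMeasure (farAtoms x I v R) lam) z‖ₑ ∂μ := by
          refine setLIntegral_mono_ae' hB ?_
          filter_upwards [hQ, key R h1 h2] with z hz1 hz2 hzB
          rw [← ofReal_norm]
          refine ENNReal.ofReal_le_ofReal ?_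
          rw [norm_sub_rev]
          linarith [hz2 hzB, norm_sub_norm_le
            (otMap μ (discreteMeasure (farAtoms x I v R) lam) z)
            (otMap μ (discreteMeasure x lam) z)]
      _ ≤ _ := lintegral_mono_set Set.inter_subset_left
  have htop : Tendsto (fun R : ℝ => ENNReal.ofReal (R - M) * μ B) atTop (𝓝 ∞) := by
    have h1 : Tendsto (fun R : ℝ => ENNReal.ofReal (R - M)) atTop (𝓝 ∞) :=
      ENNReal.tendsto_ofReal_atTop.comp (tendsto_atTop_add_const_right _ _ tendsto_id)
    have h2 := ENNReal.Tendsto.mul_const (b := μ B) h1 (Or.inl ENNReal.top_ne_zero)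
    rwa [ENNReal.top_mul hpos] at h2
  exact top_le_iff.1 (le_of_tendsto htop hbound)

/-- The divergence criterion needs a level whose halfspace is strictly lighter than the
contamination, yet with mass near `u` strictly above that level. The level is shifted up or down
according to whether the support reaches above the hyperplane through `u`. -/
theorem breaksDown_of_halfspaceDepth_le [IsProbabilityMeasure μ] (hd : 1 ≤ d)
    (hμ : ∀ v : EuclideanSpace ℝ (Fin d), v ≠ 0 → ∀ c : ℝ, μ {z | inner ℝ v z = c} = 0)
    (hconv : Convex ℝ μ.support) (h : IsAtomsWeights x lam) {u : EuclideanSpace ℝ (Fin d)}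
    (hu : u ∈ μ.support) {I : Finset (Fin n)} (hne : I.Nonempty)
    (hI : halfspaceDepth μ u ≤ ENNReal.ofReal (∑ i ∈ I, lam i)) : BreaksDown μ x lam u I := by
  intro δ hδ
  obtain ⟨v, hv, huv⟩ := exists_halfspaceDepth_eq hd hμ u
  have hv0 : v ≠ 0 := norm_ne_zero_iff.1 (by simp [hv])
  rw [huv] at hI
  have hopen : ∀ c : ℝ, IsOpen {z | c < inner ℝ v (z - u)} := fun c =>
    isOpen_lt (by fun_prop) (by fun_prop)
  by_cases hcase : ∃ s ∈ μ.support, 0 < inner ℝ v (s - u)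
  · obtain ⟨s, hs, hsu⟩ := hcase
    have hball : ∀ ε > 0, ∃ z ∈ μ.support, z ∈ Metric.ball u ε ∧ 0 < inner ℝ v (z - u) := by
      intro ε hε
      have hc : Continuous fun r : ℝ => AffineMap.lineMap u s r := AffineMap.lineMap_continuous
      have h0 := hc.tendsto 0
      rw [AffineMap.lineMap_apply_zero] at h0
      obtain ⟨r, hr, hr0, hr1⟩ := (((h0.eventually (Metric.ball_mem_nhds u hε)).filter_mono
        nhdsWithin_le_nhds).and (Ioo_mem_nhdsGT (zero_lt_one' ℝ))).exists
      refine ⟨_, hconv.lineMap_mem hu hs ⟨hr0.le, hr1.le⟩, hr, ?_⟩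
      rw [AffineMap.lineMap_apply, vsub_eq_sub, vadd_eq_add, add_sub_cancel_right,
        inner_smul_right]
      exact mul_pos hr0 hsu
    obtain ⟨z, hz, hzδ, hzpos⟩ := hball δ hδ
    obtain ⟨τ, hτ0, hτ⟩ := exists_between hzpos
    refine iSup_lintegral_otMap_eq_top hμ h hv (t := τ / 2) (η := τ / 2) (by positivity) ?_ ?_
    · rw [add_halves]
      exact (measure_pos_of_mem_support_of_isOpen hz (Metric.isOpen_ball.inter (hopen τ))
        ⟨hzδ, hτ⟩).ne'
    · refine lt_of_lt_of_le ?_ hI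
      -- Raising the level to `τ / 2` discards a neighbourhood of a support point just above the
      -- hyperplane, which makes the inequality strict.
      obtain ⟨y, hy, hyτ, hypos⟩ := hball (τ / 2) (by positivity)
      have hy' := measure_pos_of_mem_support_of_isOpen hy (Metric.isOpen_ball.inter (hopen 0))
        ⟨hyτ, hypos⟩
      have hsmall : ∀ w ∈ Metric.ball u (τ / 2), inner ℝ v (w - u) < τ / 2 := by
        intro w hw
        have h1 := real_inner_le_norm v (w - u)
        rw [hv, one_mul] at h1
        exact h1.trans_lt (by simpa [dist_eq_norm] using hw)
      have hdisj : Disjoint {z | τ / 2 ≤ inner ℝ v (z - u)}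
          (Metric.ball u (τ / 2) ∩ {z | 0 < inner ℝ v (z - u)}) := by
        rw [Set.disjoint_left]
        exact fun w hw hw' => not_lt.2 hw (hsmall w hw'.1)
      refine lt_of_lt_of_le (ENNReal.lt_add_right (measure_ne_top _ _) hy'.ne') ?_
      rw [← measure_union hdisj (Metric.isOpen_ball.inter (hopen 0)).measurableSet]
      refine measure_mono ?_
      rintro w (hw | hw)
      · exact (show (0 : ℝ) ≤ τ / 2 by positivity).trans hw
      · exact (show 0 < inner ℝ v (w - u) from hw.2).le
  · push Not at hcase
    have hzero : μ {z | 0 ≤ inner ℝ v (z - u)} = 0 := by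
      have h0 : ∀ᵐ z ∂μ, inner ℝ v z ≠ inner ℝ v u := by
        rw [ae_iff]; simpa using hμ v hv0 _
      rw [measure_eq_zero_iff_ae_notMem]
      filter_upwards [h0, Measure.support_mem_ae (μ := μ)] with z hz hzS hz0
      have hz0 : 0 ≤ inner ℝ v (z - u) := hz0
      have h1 := hcase z hzS
      rw [inner_sub_right] at hz0 h1
      exact hz (by linarith)
    have hlam : 0 < ENNReal.ofReal (∑ i ∈ I, lam i) :=
      ENNReal.ofReal_pos.2 (Finset.sum_pos (fun i _ => h.weight_pos i) hne)
    rw [measure_halfspace_sub, zero_add] at hzero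
    have h1 := tendsto_measure_halfspace hμ hv0 (inner ℝ v u)
    rw [hzero] at h1
    -- Here the halfspace at `u` is null. Since `I` is nonempty its weight is positive, so the level
    -- can drop below `u` while the halfspace stays lighter.
    obtain ⟨c, hc, hcu⟩ := (((h1.eventually_lt_const hlam).filter_mono nhdsWithin_le_nhds).and
      (self_mem_nhdsWithin (s := Set.Iio (inner ℝ v u)))).exists
    have hcu : c < inner ℝ v u := hcu
    refine iSup_lintegral_otMap_eq_top hμ h hv (t := c - inner ℝ v u)
      (η := (inner ℝ v u - c) / 2) (by linarith) ?_ ?_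
    · refine (measure_pos_of_mem_support_of_isOpen hu (Metric.isOpen_ball.inter (hopen _))
        ⟨Metric.mem_ball_self hδ, ?_⟩).ne'
      rw [Set.mem_ofPred_eq, sub_self, inner_zero_right]
      linarith
    · rw [measure_halfspace_sub, sub_add_cancel]
      exact hc

end SemiDiscreteOT

/-! ### Breakdown points as least subset weights -/

namespace SemiDiscreteOT

variable {d n : ℕ} {μ : Measure (EuclideanSpace ℝ (Fin d))}
  {x : Fin n → EuclideanSpace ℝ (Fin d)} {lam : Fin n → ℝ}

theorem finite_breakdownMasses (μ : Measure (EuclideanSpace ℝ (Fin d)))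
    (x : Fin n → EuclideanSpace ℝ (Fin d)) (lam : Fin n → ℝ) (u : EuclideanSpace ℝ (Fin d)) :
    (breakdownMasses μ x lam u).Finite :=
  (Set.finite_range fun I : Finset (Fin n) => ∑ i ∈ I, lam i).subset
    fun _ ⟨I, _, hs⟩ => ⟨I, hs.symm⟩

theorem IsAtomsWeights.univ_nonempty (h : IsAtomsWeights x lam) :
    (Finset.univ : Finset (Fin n)).Nonempty :=
  Finset.nonempty_of_sum_ne_zero (f := lam) (by rw [h.weight_sum]; exact one_ne_zero)

theorem halfspaceDepth_le_one [IsProbabilityMeasure μ] (hd : 1 ≤ d)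
    (u : EuclideanSpace ℝ (Fin d)) : halfspaceDepth μ u ≤ 1 := by
  obtain ⟨v, hv⟩ := nonempty_unit_sphere hd
  exact (SemiDiscreteOT.halfspaceDepth_le μ (ne_zero_of_mem_unit_sphere ⟨v, hv⟩) u).trans
    prob_le_one

/-- The minimum defining the breakdown point is attained. -/
theorem IsAtomsWeights.isLeast_breakdownPoint [IsProbabilityMeasure μ] (hd : 1 ≤ d)
    (hμ : ∀ v : EuclideanSpace ℝ (Fin d), v ≠ 0 → ∀ c : ℝ, μ {z | inner ℝ v z = c} = 0)
    (hconv : Convex ℝ μ.support) (h : IsAtomsWeights x lam) {u : EuclideanSpace ℝ (Fin d)}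
    (hu : u ∈ μ.support) :
    IsLeast (breakdownMasses μ x lam u) (breakdownPoint μ x lam u) := by
  have hfin := finite_breakdownMasses μ x lam u
  have hne : (breakdownMasses μ x lam u).Nonempty :=
    ⟨_, Finset.univ, breaksDown_of_halfspaceDepth_le hd hμ hconv h hu h.univ_nonempty
      (by simpa [h.weight_sum] using halfspaceDepth_le_one hd u), rfl⟩
  exact ⟨hne.csInf_mem hfin, fun s hs => csInf_le hfin.bddBelow hs⟩

/-- At positive depth, the breakdown point is the least total weight that is at least the depth. -/
theorem IsAtomsWeights.isLeast_weightSumsGE_breakdownPoint [IsProbabilityMeasure μ] (hd : 1 ≤ d)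
    (hμ : ∀ v : EuclideanSpace ℝ (Fin d), v ≠ 0 → ∀ c : ℝ, μ {z | inner ℝ v z = c} = 0)
    (hconv : Convex ℝ μ.support) (h : IsAtomsWeights x lam) {u : EuclideanSpace ℝ (Fin d)}
    (hu : u ∈ μ.support) {t : ℝ} (ht : 0 < t) (hut : halfspaceDepth μ u = ENNReal.ofReal t) :
    IsLeast (weightSumsGE lam t) (breakdownPoint μ x lam u) := by
  have heq : breakdownMasses μ x lam u = weightSumsGE lam t := by
    ext s
    constructor
    · rintro ⟨I, hI, rfl⟩
      refine ⟨I, rfl, ?_⟩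
      have h1 := hI.halfspaceDepth_le hμ h
      rw [hut] at h1
      exact (ENNReal.ofReal_le_ofReal_iff
        (Finset.sum_nonneg fun i _ => (h.weight_pos i).le)).1 h1
    · rintro ⟨I, rfl, hI⟩
      refine ⟨I, breaksDown_of_halfspaceDepth_le hd hμ hconv h hu
        -- Positivity of `t` rules out the empty set, which never breaks the map down.
        (Finset.nonempty_of_sum_ne_zero (ht.trans_le hI).ne') ?_, rfl⟩
      rw [hut]
      exact ENNReal.ofReal_le_ofReal hI
  rw [← heq]
  exact h.isLeast_breakdownPoint hd hμ hconv hu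

theorem isAtomsWeights_empirical (hn : 1 ≤ n) (hx : Function.Injective x) :
    IsAtomsWeights x fun _ => 1 / (n : ℝ) := by
  have hn' : (0 : ℝ) < n := by exact_mod_cast hn
  refine ⟨hx, fun _ => by positivity, ?_⟩
  rw [Finset.sum_const, Finset.card_univ, Fintype.card_fin, nsmul_eq_mul]
  exact mul_one_div_cancel hn'.ne'

theorem isLeast_weightSumsGE_empirical (hn : 1 ≤ n) :
    IsLeast (weightSumsGE (fun _ : Fin n => 1 / (n : ℝ)) (1 / 2))
      ((⌈(n : ℝ) / 2⌉₊ : ℝ) / n) := by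
  have hn' : (0 : ℝ) < n := by exact_mod_cast hn
  constructor
  · have hle : ⌈(n : ℝ) / 2⌉₊ ≤ (Finset.univ : Finset (Fin n)).card := by
      rw [Finset.card_univ, Fintype.card_fin, Nat.ceil_le]
      linarith
    obtain ⟨I, -, hI⟩ := Finset.exists_subset_card_eq hle
    refine ⟨I, ?_, ?_⟩
    · rw [Finset.sum_const, hI, nsmul_eq_mul, mul_one_div]
    · rw [le_div_iff₀ hn']
      linarith [Nat.le_ceil ((n : ℝ) / 2)]
  · rintro s ⟨I, rfl, hI⟩
    rw [Finset.sum_const, nsmul_eq_mul, mul_one_div] at hI ⊢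
    rw [le_div_iff₀ hn'] at hI
    gcongr
    rw [Nat.ceil_le]
    linarith

end SemiDiscreteOT

/-! ### The main theorem -/

open SemiDiscreteOT
theorem corollary1 {d : ℕ} (hd : 1 ≤ d) (μ : Measure (EuclideanSpace ℝ (Fin d)))
    [IsProbabilityMeasure μ] (hac : μ ≪ volume) (hconv : Convex ℝ μ.support) :
    -- the breakdown points are minima, and a Tukey median exists
    (∀ (n : ℕ) (x : Fin n → EuclideanSpace ℝ (Fin d)) (lam : Fin n → ℝ), IsAtomsWeights x lam →
      ∀ u ∈ μ.support, IsLeast (breakdownMasses μ x lam u) (breakdownPoint μ x lam u)) ∧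
    (∃ u, IsTukeyMedian μ u) ∧
    -- (i)
    (∀ u, IsTukeyMedian μ u →
      ∀ (n : ℕ) (x : Fin n → EuclideanSpace ℝ (Fin d)) (lam : Fin n → ℝ), IsAtomsWeights x lam →
        IsGreatest (breakdownPoint μ x lam '' μ.support) (breakdownPoint μ x lam u) ∧
        ∃ s, IsLeast (weightSumsGE lam (1 / ((d : ℝ) + 1))) s ∧ s ≤ breakdownPoint μ x lam u) ∧
    -- (ii)
    (∀ θ, AngularlySymmetric μ θ →
      (∀ u, IsTukeyMedian μ u ↔ u = θ) ∧
      (∀ (n : ℕ) (x : Fin n → EuclideanSpace ℝ (Fin d)) (lam : Fin n → ℝ), IsAtomsWeights x lam →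
        IsLeast (weightSumsGE lam (1 / 2)) (breakdownPoint μ x lam θ)) ∧
      (∀ (n : ℕ) (x : Fin n → EuclideanSpace ℝ (Fin d)), 1 ≤ n → Function.Injective x →
        breakdownPoint μ x (fun _ => 1 / (n : ℝ)) θ = (⌈(n : ℝ) / 2⌉₊ : ℝ) / n) ∧
      (∀ x : (n : ℕ) → Fin n → EuclideanSpace ℝ (Fin d), (∀ n, Function.Injective (x n)) →
        Tendsto (fun n : ℕ => breakdownPoint μ (x n) (fun _ => 1 / (n : ℝ)) θ) atTop
          (𝓝 (1 / 2)))) := by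
  have hμ := measure_hyperplane_eq_zero hac
  refine ⟨fun n x lam h u hu => h.isLeast_breakdownPoint hd hμ hconv hu,
    exists_isTukeyMedian hd hμ hconv, fun u hu n x lam h => ?_, fun θ hθ => ?_⟩
  · have hdepth := hu.le_halfspaceDepth hd hμ hconv
    have hpos : 0 < 1 / ((d : ℝ) + 1) := by positivity
    have hleast := h.isLeast_breakdownPoint hd hμ hconv hu.1
    obtain ⟨I, hI, hIs⟩ := hleast.1
    have hIdepth := hI.halfspaceDepth_le hμ h
    have hIge : 1 / ((d : ℝ) + 1) ≤ ∑ i ∈ I, lam i :=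
      (ENNReal.ofReal_le_ofReal_iff (Finset.sum_nonneg fun i _ => (h.weight_pos i).le)).1
        (hdepth.trans hIdepth)
    have hIne : I.Nonempty := Finset.nonempty_of_sum_ne_zero (hpos.trans_le hIge).ne'
    refine ⟨⟨⟨u, hu.1, rfl⟩, ?_⟩, ?_⟩
    -- The set `I` optimal at the median outweighs the depth of `u`, hence that of `z`, and so
    -- breaks the map down at `z` as well.
    · rintro _ ⟨z, hz, rfl⟩
      exact (h.isLeast_breakdownPoint hd hμ hconv hz).2
        ⟨I, breaksDown_of_halfspaceDepth_le hd hμ hconv h hz hIne ((hu.2 z hz).trans hIdepth), hIs⟩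
    · have hfin : (weightSumsGE lam (1 / ((d : ℝ) + 1))).Finite :=
        (Set.finite_range fun I : Finset (Fin n) => ∑ i ∈ I, lam i).subset
          fun _ ⟨I, hs, _⟩ => ⟨I, hs.symm⟩
      have hmem : breakdownPoint μ x lam u ∈ weightSumsGE lam (1 / ((d : ℝ) + 1)) :=
        ⟨I, hIs, hIs ▸ hIge⟩
      exact ⟨_, ⟨Set.Nonempty.csInf_mem ⟨_, hmem⟩ hfin, fun s hs => csInf_le hfin.bddBelow hs⟩,
        csInf_le hfin.bddBelow hmem⟩
  · have hiff := hθ.isTukeyMedian_iff hd hμ hconv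
    have hθS : θ ∈ μ.support := ((hiff θ).2 rfl).1
    have hleast : ∀ (n : ℕ) (x : Fin n → EuclideanSpace ℝ (Fin d)) (lam : Fin n → ℝ),
        IsAtomsWeights x lam → IsLeast (weightSumsGE lam (1 / 2)) (breakdownPoint μ x lam θ) :=
      fun n x lam h => h.isLeast_weightSumsGE_breakdownPoint hd hμ hconv hθS (by norm_num)
        (hθ.halfspaceDepth_eq hd hμ)
    have hemp : ∀ (n : ℕ) (x : Fin n → EuclideanSpace ℝ (Fin d)), 1 ≤ n →
        Function.Injective x →
        breakdownPoint μ x (fun _ => 1 / (n : ℝ)) θ = (⌈(n : ℝ) / 2⌉₊ : ℝ) / n :=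
      fun n x hn hx => (hleast n x _ (isAtomsWeights_empirical hn hx)).unique
        (isLeast_weightSumsGE_empirical hn)
    refine ⟨hiff, hleast, hemp, fun x hx => ?_⟩
    have hlim := (tendsto_nat_ceil_mul_div_atTop (R := ℝ) (a := 1 / 2) (by norm_num)).comp
      (tendsto_natCast_atTop_atTop (R := ℝ))
    refine hlim.congr' ?_
    filter_upwards [eventually_ge_atTop 1] with n hn
    rw [hemp n (x n) hn (hx n), Function.comp_apply, one_div_mul_eq_div]
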